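/- Let $G$ be a finite connected plane graph (a connected planar graph, parallel edges and loops allowed, with a fixed drawing in the plane). For a spanning tree $T$ of $G$ and an edge $e$ of $T$ let $A_e,B_e$ be the vertex sets of the two components of $T-e$, and let $e_G(A_e,B_e)$ be the number of edges of $G$ with one end in $A_e$ and the other in $B_e$. The spanning tree congestion of $G$ is $$s(G)=\min_{T}\ \max_{e\in E(T)} e_G(A_e,B_e),$$ where $T$ runs over all spanning trees of $G$. The dual graph $G^*$ has as vertices the faces of $G$, including the exterior face $O$, and for each edge $e$ of $G$ it has an edge $e^*$ joining the faces on the two sides of $e$ (a loop if these coincide). An edge of $G$ is an outer edge if it occurs in the boundary of $O$ and in the boundary of an interior (bounded) face. Assume that no outer edge is a loop. For an outer edge $e$ and an interior face $F$ let the index $i(F,e)$ be the length of a shortest path (without repeated vertices) in $G^*$ from $O$ to $F$ whose first edge is $e^*$, and $i(F,e)=\infty$ if there is no such path. A center-tail system $\mathcal S$ in $G^*$ consists of (1) a non-empty set $C$ of interior faces that induces a connected subgraph of $G^*$ (the center); (2) a set of paths in $G^*$, called tails, each going from a face in $C$ to $O$; the tip of a tail is its last vertex before $O$; (3) an assignment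 to each outer edge $e$ of one of the tails, its opposite tail $N(e)$, whose tip is denoted $t(e)$. The congestion indicator $\mathrm{CI}(\mathcal S)$ is the minimum of the following three numbers, where a minimum over the empty set is $\infty$: 1. $\min\,\bigl(i(F,f)+i(H,h)+1\bigr)$ over all pairs $F\neq H$ of faces in $C$ that are adjacent in $G^*$ and all pairs $f\ne h$ of outer edges; 2. $\min_e i(t(e),e)+1$ over all outer edges $e$; 3. $\min\,\bigl(i(F,e)+i(\widetilde F,\tilde e)+1\bigr)$ over all outer edges $e$, all faces $F\neq t(e)$, $F\neq O$ on the path $N(e)$, with $\widetilde F$ the face that follows $F$ on $N(e)$, and all outer edges $\tilde e\neq e$. Then for every center-tail system $\mathcal S$ in $G^*$ $$s(G)\ \ge\ \mathrm{CI}(\mathcal S).$$ -/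

import Mathlib

open scoped Graph

/-! ## Walks, trees and spanning tree congestion in multigraphs -/

namespace Graph

variable {α β : Type*}

/-- Walks in a multigraph, recording the vertices and the edges that are traversed. -/
inductive Walk (G : Graph α β) : α → α → Type _
  | nil {x : α} (hx : x ∈ V(G)) : Walk G x x
  | cons {x y z : α} (e : β) (h : G.IsLink e x y) (p : Walk G y z) : Walk G x z

namespace Walk

variable {G : Graph α β}

/-- The list of vertices of a walk, in order. -/
def support : {x y : α} → G.Walk x y → List α
  | x, _, nil _ => [x]
  | x, _, cons _ _ p => x :: p.support

/-- The list of edges of a walk, in order. -/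
def edges : {x y : α} → G.Walk x y → List β
  | _, _, nil _ => []
  | _, _, cons e _ p => e :: p.edges

/-- The length of a walk is its number of edges. -/
def length {x y : α} (p : G.Walk x y) : ℕ := p.edges.length

/-- A path is a walk without repeated vertices. -/
def IsPath {x y : α} (p : G.Walk x y) : Prop := p.support.Nodup

/-- A cycle is a closed walk with at least one edge, without repeated edges, and without repeated
vertices except that the first vertex equals the last one.  (A loop is a cycle of length one and
two parallel edges form a cycle of length two.) -/
def IsCycle {x : α} (p : G.Walk x x) : Prop :=
  p.edges ≠ [] ∧ p.edges.Nodup ∧ p.support.tail.Nodup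

end Walk

/-- Two vertices are joined by a walk. -/
def Reachable (G : Graph α β) (x y : α) : Prop := Nonempty (G.Walk x y)

/-- A multigraph is connected if it has a vertex and any two of its vertices are joined by a
walk. -/
def Connected (G : Graph α β) : Prop :=
  V(G).Nonempty ∧ ∀ x ∈ V(G), ∀ y ∈ V(G), G.Reachable x y

/-- A tree is a connected graph without cycles. -/
def IsTree (T : Graph α β) : Prop :=
  T.Connected ∧ ∀ (x : α) (p : T.Walk x x), ¬ p.IsCycle

/-- `T` is a spanning tree of `G`. -/
def IsSpanningTree (G T : Graph α β) : Prop := T ≤s G ∧ T.IsTree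

/-- The edges of `G` having one end in `A` and the other end in `B`. -/
def edgesBetween (G : Graph α β) (A B : Set α) : Set β :=
  {f | ∃ a ∈ A, ∃ b ∈ B, G.IsLink f a b}

/-- The vertex set of the component of `G` that contains the vertex `x`. -/
def component (G : Graph α β) (x : α) : Set α := {a | G.Reachable x a}

/-- For an edge `e` of a tree `T` with ends `x, y`: the edges of `G` that join the vertex set of
the component of `T - e` containing `x` to the vertex set of the component of `T - e`
containing `y`. -/
def detourEdges (G T : Graph α β) (e : β) : Set β :=
  {f | ∃ x y, T.IsLink e x y ∧
    f ∈ G.edgesBetween ((T.deleteEdges {e}).component x) ((T.deleteEdges {e}).component y)}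

/-- The edge congestion of `G` in `T`. -/
noncomputable def edgeCongestion (G T : Graph α β) : ℕ∞ :=
  ⨆ e ∈ E(T), (G.detourEdges T e).encard

/-- The spanning tree congestion of `G`. -/
noncomputable def spanningTreeCongestion (G : Graph α β) : ℕ∞ :=
  ⨅ (T : Graph α β) (_ : G.IsSpanningTree T), G.edgeCongestion T

end Graph

/-! ## Plane graphs and their duals -/

/-- A drawing of the multigraph `G` in the plane `ℂ`: distinct vertices are placed at distinct
points, each edge is drawn as a curve between its ends which does not pass twice through an
interior point, interior points of edges are not vertices and do not lie on other edges.
(So the edges with distinct ends are simple arcs and loops are simple closed curves.) -/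
structure PlaneDrawing {α β : Type*} (G : Graph α β) where
  /-- The position of a vertex. -/
  pos : α → ℂ
  /-- The curve that represents an edge, parametrized by the interval `[0, 1]`. -/
  arc : β → ℝ → ℂ
  pos_injOn : Set.InjOn pos V(G)
  arc_continuousOn : ∀ e ∈ E(G), ContinuousOn (arc e) (Set.Icc 0 1)
  arc_ends : ∀ e ∈ E(G), ∃ x y, G.IsLink e x y ∧ arc e 0 = pos x ∧ arc e 1 = pos y
  arc_injOn : ∀ e ∈ E(G), Set.InjOn (arc e) (Set.Ioo 0 1)
  arc_ne_pos : ∀ e ∈ E(G), ∀ t ∈ Set.Ioo (0 : ℝ) 1, ∀ x ∈ V(G), arc e t ≠ pos x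
  arc_ne_arc : ∀ e ∈ E(G), ∀ f ∈ E(G), e ≠ f →
    ∀ s ∈ Set.Ioo (0 : ℝ) 1, ∀ t ∈ Set.Ioo (0 : ℝ) 1, arc e s ≠ arc f t

namespace PlaneDrawing

variable {α β : Type*} {G : Graph α β} (D : PlaneDrawing G)

/-- The points of the plane that lie on a given edge (ends included). -/
def edgeCurve (e : β) : Set ℂ := D.arc e '' Set.Icc 0 1

/-- The points of the plane that are vertices or lie on edges. -/
def carrier : Set ℂ := D.pos '' V(G) ∪ ⋃ e ∈ E(G), D.edgeCurve e

/-- The faces are the connected components of the complement of the drawing. -/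
def IsFace (F : Set ℂ) : Prop := ∃ z ∈ D.carrierᶜ, F = connectedComponentIn D.carrierᶜ z

/-- The exterior (unbounded) face. -/
def outerFace : Set ℂ :=
  {z | z ∈ D.carrierᶜ ∧ ¬ Bornology.IsBounded (connectedComponentIn D.carrierᶜ z)}

/-- The interior faces. -/
def IsInnerFace (F : Set ℂ) : Prop := D.IsFace F ∧ F ≠ D.outerFace

/-- The edge `e` occurs in the boundary of `F`. -/
def InBoundary (e : β) (F : Set ℂ) : Prop := e ∈ E(G) ∧ D.edgeCurve e ⊆ frontier F

/-- The dual graph.  Its vertices are the faces.  The dual edge of `e` (again called `e`) joins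
the faces having `e` in their boundary; it is a loop if there is only one such face. -/
def dual : Graph (Set ℂ) β where
  vertexSet := {F | D.IsFace F}
  IsLink e F H := e ∈ E(G) ∧ {X | D.IsFace X ∧ D.InBoundary e X} = {F, H}
  isLink_symm := by
    intro e _
    refine ⟨fun F H h => ⟨h.1, ?_⟩⟩
    rw [h.2, Set.pair_comm]
  eq_or_eq_of_isLink_of_isLink := by
    intro e x y v w h₁ h₂
    have hx : x ∈ ({v, w} : Set (Set ℂ)) := by
      rw [← h₂.2, h₁.2]
      exact Set.mem_insert x {y}
    exact hx
  left_mem_of_isLink := by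
    intro e x y h
    have hx : x ∈ {X | D.IsFace X ∧ D.InBoundary e X} := by
      rw [h.2]
      exact Set.mem_insert x {y}
    exact hx.1

/-- An outer edge occurs in the boundaries of the exterior face and of an interior face. -/
def IsOuterEdge (e : β) : Prop :=
  D.InBoundary e D.outerFace ∧ ∃ F, D.IsInnerFace F ∧ D.InBoundary e F

/-- The index `i(F, e)`: the length of a shortest path in the dual graph from the exterior face to
`F` whose first edge is the dual edge of `e`; it is `⊤` if there is no such path. -/
noncomputable def index (F : Set ℂ) (e : β) : ℕ∞ :=
  ⨅ (p : D.dual.Walk D.outerFace F) (_ : p.IsPath ∧ p.edges.head? = some e), (p.length : ℕ∞)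

/-- A path in the dual graph from an interior face to the exterior face. -/
structure Tail where
  /-- The first face of the path. -/
  start : Set ℂ
  start_inner : D.IsInnerFace start
  /-- The path. -/
  walk : D.dual.Walk start D.outerFace
  isPath : walk.IsPath

namespace Tail

variable {D}

/-- The faces of a tail in order, without the exterior face in which it ends. -/
def faces (τ : D.Tail) : List (Set ℂ) := τ.walk.support.dropLast

/-- The tip: the last face of a tail before it reaches the exterior face.  (The list `τ.faces` is
never empty, so that the default value is not used.) -/
def tip (τ : D.Tail) : Set ℂ := τ.faces.getLastD τ.start

end Tail

end PlaneDrawing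

/-- A center-tail system in the dual graph of a plane graph. -/
structure CenterTailSystem {α β : Type*} {G : Graph α β} (D : PlaneDrawing G) where
  /-- The center. -/
  center : Set (Set ℂ)
  center_inner : ∀ F ∈ center, D.IsInnerFace F
  center_connected : (D.dual.induce center).Connected
  /-- The tails. -/
  tails : Set D.Tail
  start_mem_center : ∀ τ ∈ tails, τ.start ∈ center
  /-- The opposite tail of an outer edge. -/
  opp : {e : β // D.IsOuterEdge e} → D.Tail
  opp_mem_tails : ∀ e, opp e ∈ tails

namespace CenterTailSystem

variable {α β : Type*} {G : Graph α β} {D : PlaneDrawing G} (S : CenterTailSystem D)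

/-- The minimum of `i(F, f) + i(H, h) + 1` over adjacent faces `F ≠ H` of the center and outer
edges `f ≠ h`. -/
noncomputable def centerMin : ℕ∞ :=
  ⨅ (F ∈ S.center) (H ∈ S.center) (_ : F ≠ H ∧ D.dual.Adj F H)
    (f : {e : β // D.IsOuterEdge e}) (h : {e : β // D.IsOuterEdge e}) (_ : f ≠ h),
    (D.index F f + D.index H h + 1)

/-- The minimum of `i(t(e), e) + 1` over the outer edges `e`. -/
noncomputable def tipMin : ℕ∞ :=
  ⨅ e : {e : β // D.IsOuterEdge e}, (D.index (S.opp e).tip e + 1)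

/-- The minimum of `i(F, e) + i(F', e') + 1` over the outer edges `e ≠ e'` and the faces `F` of the
opposite tail `N(e)` other than its tip, where `F'` is the face following `F` on `N(e)`. -/
noncomputable def tailMin : ℕ∞ :=
  ⨅ (e : {e : β // D.IsOuterEdge e}) (F : Set ℂ) (F' : Set ℂ) (_ : [F, F'] <:+: (S.opp e).faces)
    (e' : {e : β // D.IsOuterEdge e}) (_ : e' ≠ e),
    (D.index F e + D.index F' e' + 1)

/-- The congestion indicator. -/
noncomputable def congestionIndicator : ℕ∞ := min S.centerMin (min S.tipMin S.tailMin)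

end CenterTailSystem

/-!
The argument is by planar duality.  Let `T` be a spanning tree of `G`.  The dual edges of the edges
outside `T` connect all faces (`PlaneDrawing.reachable_dual_restrict`), so the faces carry a
breadth-first search tree rooted at the exterior face whose edges lie outside `T`.  Give every
interior face the *label* that is the outer edge in which its path to the root ends.  Whenever two
faces are joined by a dual edge `g` and their paths to the root are disjoint and avoid `g`, the edge
`g` belongs to `T` and all edges of the two paths, together with `g`, join the two components of
`T - g` (`PlaneDrawing.depth_add_depth_add_one_le`); so the congestion of `T` is at least the sum of
the two depths plus one, and the depths bound the indices from above.

It remains to find a suitable pair of faces.  If the label is not constant on the center, two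
adjacent faces of the center have different labels.  If it has the constant value `e`, then along
the tail opposite to `e` either the label changes, or the tip has label `e` and is adjacent to the
exterior face.  These are the three terms of the congestion indicator.  In the last case the edge
between the tip and the exterior face may belong to the search tree; then the bound to be proved is
`2`, and it holds because `e` is not a loop.

The topological facts are obtained without the Jordan curve theorem, from the criterion of
Eilenberg: a compact set `K` does not separate `p` and `q` if and only if `(z - p) / (z - q)` has a
continuous logarithm on `K` (`hasLogOn_div_of_isPreconnected`,
`mem_connectedComponentIn_of_hasLogOn`).  Logarithms on a compact set and on an arc attached to it
can be glued unless they jump by a nonzero multiple of `2πi`.  This yields that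
* the drawing of a tree does not separate the plane (`isPreconnected_compl_sketch_of_isTree`);
* an edge lies in the boundary of at most two faces, and entirely so as soon as it meets the
  boundary in an interior point (`IsAttachedArc.two_components`,
  `IsAttachedArc.image_subset_frontier`), so that every edge has a dual edge;
* if `e` lies on a cycle and separates two different faces, then a walk in the dual graph between
  these faces has to cross the cycle (`PlaneDrawing.eq_of_reachable_of_isLink`): the jump along `e`
  is nonzero in the whole drawing, and it is already determined by the cycle.
-/

/-! ### Continuous logarithms on subsets of the plane -/

/-- The function `h` has a continuous logarithm on `K`.  The logarithm is a function on all of `ℂ`,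
whose values outside `K` are irrelevant. -/
def HasLogOn (h : ℂ → ℂ) (K : Set ℂ) : Prop :=
  ∃ g : ℂ → ℂ, ContinuousOn g K ∧ ∀ z ∈ K, Complex.exp (g z) = h z

namespace HasLogOn

variable {h h' : ℂ → ℂ} {K L : Set ℂ}

theorem mono (hh : HasLogOn h K) (hL : L ⊆ K) : HasLogOn h L := by
  obtain ⟨g, hg, hexp⟩ := hh
  exact ⟨g, hg.mono hL, fun z hz => hexp z (hL hz)⟩

theorem congr (hh : HasLogOn h K) (e : ∀ z ∈ K, h z = h' z) : HasLogOn h' K := by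
  obtain ⟨g, hg, hexp⟩ := hh
  exact ⟨g, hg, fun z hz => (hexp z hz).trans (e z hz)⟩

theorem mul (hh : HasLogOn h K) (hh' : HasLogOn h' K) : HasLogOn (fun z => h z * h' z) K := by
  obtain ⟨g, hg, hexp⟩ := hh
  obtain ⟨g', hg', hexp'⟩ := hh'
  exact ⟨fun z => g z + g' z, hg.add hg', fun z hz => by
    rw [Complex.exp_add, hexp z hz, hexp' z hz]⟩

theorem inv (hh : HasLogOn h K) : HasLogOn (fun z => (h z)⁻¹) K := by
  obtain ⟨g, hg, hexp⟩ := hh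
  exact ⟨fun z => -g z, hg.neg, fun z hz => by rw [Complex.exp_neg, hexp z hz]⟩

end HasLogOn

/-- Two continuous logarithms of the same function differ by a constant on a connected set. -/
theorem exists_int_sub_eq_of_exp_eq {X : Type*} [TopologicalSpace X] {S : Set X}
    (hS : IsPreconnected S) {g₁ g₂ : X → ℂ} (h₁ : ContinuousOn g₁ S) (h₂ : ContinuousOn g₂ S)
    (h : ∀ z ∈ S, Complex.exp (g₁ z) = Complex.exp (g₂ z)) :
    ∃ n : ℤ, ∀ z ∈ S, g₁ z = g₂ z + n * (2 * Real.pi * Complex.I) := by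
  have hpi : (2 * Real.pi * Complex.I : ℂ) ≠ 0 := Complex.two_pi_I_ne_zero
  have hd : IsDiscrete (Set.range (fun n : ℤ => (n : ℝ))) :=
    Int.isClosedEmbedding_coe_real.isEmbedding.isDiscrete_range
  have key : ∀ z ∈ S, ∃ n : ℤ, g₁ z = g₂ z + n * (2 * Real.pi * Complex.I) := fun z hz =>
    Complex.exp_eq_exp_iff_exists_int.1 (h z hz)
  obtain ⟨y, ⟨n, rfl⟩, hy⟩ := hS.eqOn_const_of_mapsTo hd
    (f := fun z => ((g₁ z - g₂ z) / (2 * Real.pi * Complex.I)).re)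
    (Complex.continuous_re.comp_continuousOn ((h₁.sub h₂).div_const _))
    (fun z hz => by
      obtain ⟨n, hn⟩ := key z hz
      refine ⟨n, ?_⟩
      simp only [hn, add_sub_cancel_left]
      rw [mul_div_cancel_right₀ _ hpi]
      simp) ⟨_, 0, rfl⟩
  refine ⟨n, fun z hz => ?_⟩
  obtain ⟨m, hm⟩ := key z hz
  have := hy hz
  simp only [hm, add_sub_cancel_left, Function.const] at this
  rw [mul_div_cancel_right₀ _ hpi] at this
  have hmn : m = n := by exact_mod_cast (show ((m : ℂ)).re = (n : ℝ) from this)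
  rw [hm, hmn]

/-- Nonvanishing continuous functions on simply connected spaces such as the line and the plane have
continuous logarithms. -/
theorem exists_log_of_continuous {X : Type*} [TopologicalSpace X] [SimplyConnectedSpace X]
    [LocallyPathConnectedSpace X] {F : X → ℂ} (hF : Continuous F) (h0 : ∀ z, F z ≠ 0) :
    ∃ g : X → ℂ, Continuous g ∧ ∀ z, Complex.exp (g z) = F z := by
  obtain ⟨x₀⟩ : Nonempty X := inferInstance
  obtain ⟨g, ⟨-, hg⟩, -⟩ := Complex.isCoveringMapOn_exp.existsUnique_continuousMap_lifts
    ⟨F, hF⟩ (a₀ := x₀) (e₀ := Complex.log (F x₀)) (Complex.exp_log (h0 x₀)) h0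
  exact ⟨g, g.continuous, fun z => congrFun hg z⟩

theorem exists_log_Icc {a b : ℝ} (hab : a ≤ b) {u : ℝ → ℂ} (hu : ContinuousOn u (Set.Icc a b))
    (h0 : ∀ t ∈ Set.Icc a b, u t ≠ 0) :
    ∃ g : ℝ → ℂ, ContinuousOn g (Set.Icc a b) ∧ ∀ t ∈ Set.Icc a b, Complex.exp (g t) = u t := by
  obtain ⟨g, hg, hexp⟩ := exists_log_of_continuous
    (F := Set.IccExtend hab ((Set.Icc a b).domRestrict u))
    (continuousOn_iff_continuous_domRestrict.mp hu).Icc_extend' (fun t => h0 _ (Subtype.prop _))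
  refine ⟨g, hg.continuousOn, fun t ht => ?_⟩
  rw [hexp, Set.IccExtend_of_mem _ _ ht]
  rfl

/-! ### The Eilenberg criterion -/

/-- If `p` and `q` lie in a connected set that misses the closed set `K`, then `(z - p) / (z - q)`
has a continuous logarithm on `K`. -/
theorem hasLogOn_div_of_isPreconnected {K S : Set ℂ} (hK : IsClosed K) (hS : IsPreconnected S)
    (hKS : S ⊆ Kᶜ) {p q : ℂ} (hp : p ∈ S) (hq : q ∈ S) :
    HasLogOn (fun z => (z - p) / (z - q)) K := by
  refine hS.induction₂ (fun p q => HasLogOn (fun z => (z - p) / (z - q)) K) ?_ ?_ ?_ hp hq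
  · intro x hx
    obtain ⟨ε, hε, hball⟩ := Metric.isOpen_iff.1 hK.isOpen_compl x (hKS hx)
    refine mem_nhdsWithin_of_mem_nhds ?_
    filter_upwards [Metric.ball_mem_nhds x (half_pos hε)] with y hy
    have hzy : ∀ z ∈ K, ‖y - x‖ < ‖z - y‖ ∧ z - y ≠ 0 := by
      intro z hz
      have h1 : ε ≤ dist z x := by
        by_contra hlt
        exact hball (Metric.mem_ball.2 (not_le.1 hlt)) hz
      have h2 : dist y x < ε / 2 := hy
      have h3 := dist_triangle z y x
      have h4 : dist y x < dist z y := by linarith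
      rw [dist_eq_norm, dist_eq_norm] at h4
      exact ⟨h4, norm_pos_iff.1 (lt_of_le_of_lt (norm_nonneg _) h4)⟩
    have hslit : ∀ z ∈ K, (z - x) / (z - y) ∈ Complex.slitPlane := by
      intro z hz
      obtain ⟨h1, h2⟩ := hzy z hz
      have h3 : ‖(y - x) / (z - y)‖ < 1 := by
        rw [norm_div, div_lt_one (norm_pos_iff.2 h2)]
        exact h1
      convert Complex.mem_slitPlane_of_norm_lt_one h3 using 1
      field_simp
      ring
    refine ⟨fun z => Complex.log ((z - x) / (z - y)), ?_, fun z hz =>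
      Complex.exp_log (Complex.slitPlane_ne_zero (hslit z hz))⟩
    refine ContinuousOn.clog ?_ hslit
    exact ContinuousOn.div (by fun_prop) (by fun_prop) fun z hz => (hzy z hz).2
  · intro x y z _ hy _ hxy hyz
    refine (hxy.mul hyz).congr fun w hw => ?_
    have : w - y ≠ 0 := fun h => hKS hy (sub_eq_zero.1 h ▸ hw)
    field_simp
  · intro x y _ _ hxy
    exact hxy.inv.congr fun w _ => by rw [inv_div]

/-- A nonvanishing continuous function on the plane has winding number `0` along large circles. -/
theorem eq_zero_of_eq_zpow {F : ℂ → ℂ} (hF : Continuous F) (h0 : ∀ z, F z ≠ 0) {p : ℂ} {m : ℤ}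
    {R : ℝ} (hR : ∀ z, R < ‖z - p‖ → F z = (z - p) ^ m) : m = 0 := by
  obtain ⟨g, hg, hexp⟩ := exists_log_of_continuous hF h0
  set ρ : ℝ := |R| + 1 with hρ
  have hρ0 : 0 < ρ := by positivity
  let c : ℝ → ℂ := fun θ => Real.log ρ + θ * Complex.I
  have hc : Continuous c := by fun_prop
  have hexpc : ∀ θ, Complex.exp (c θ) = ρ * Complex.exp (θ * Complex.I) := by
    intro θ
    simp only [c, Complex.exp_add, ← Complex.ofReal_exp, Real.exp_log hρ0]
  have hF' : ∀ θ, F (p + Complex.exp (c θ)) = Complex.exp (c θ) ^ m := by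
    intro θ
    rw [hR _ _, add_sub_cancel_left]
    rw [add_sub_cancel_left, hexpc, norm_mul, Complex.norm_exp_ofReal_mul_I, mul_one,
      Complex.norm_real, Real.norm_of_nonneg hρ0.le]
    linarith [le_abs_self R]
  obtain ⟨n, hn⟩ := exists_int_sub_eq_of_exp_eq (isPreconnected_univ (α := ℝ))
    (g₁ := fun θ => g (p + Complex.exp (c θ))) (g₂ := fun θ => m * c θ)
    (by fun_prop) (by fun_prop) (fun θ _ => by rw [hexp, hF', Complex.exp_int_mul])
  have h1 := hn 0 trivial
  have h2 := hn (2 * Real.pi) trivial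
  have hper : Complex.exp (c 0) = Complex.exp (c (2 * Real.pi)) := by
    rw [hexpc, hexpc]
    simp [Complex.exp_two_pi_mul_I]
  rw [hper, h2] at h1
  have h3 : (m : ℂ) * (c (2 * Real.pi) - c 0) = 0 := by linear_combination h1
  have h4 : c (2 * Real.pi) - c 0 = 2 * Real.pi * Complex.I := by
    simp only [c]
    push_cast
    ring
  rw [h4] at h3
  rcases mul_eq_zero.1 h3 with h | h
  · exact_mod_cast h
  · exact absurd h Complex.two_pi_I_ne_zero

theorem frontier_connectedComponentIn_subset {K : Set ℂ} (hK : IsClosed K) (p : ℂ) :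
    frontier (connectedComponentIn Kᶜ p) ⊆ K := by
  intro z hz
  by_contra hzK
  have hopen : IsOpen (connectedComponentIn Kᶜ z) := hK.isOpen_compl.connectedComponentIn
  have hmem : z ∈ connectedComponentIn Kᶜ z := mem_connectedComponentIn hzK
  obtain ⟨w, hw1, hw2⟩ := mem_closure_iff.1 hz.1 _ hopen hmem
  have := (connectedComponentIn_eq hw1).trans (connectedComponentIn_eq hw2).symm
  refine hz.2 ?_
  rw [(hK.isOpen_compl.connectedComponentIn (x := p)).interior_eq, ← this]
  exact hmem

/-- Suppose that `p` lies in a bounded component `X` of the complement of `K`.  If `(z - p) ^ m`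
times a nonvanishing continuous function on the closure of `X` has a continuous logarithm on `K`,
then `m = 0`: extending the logarithm over `X` one obtains a nonvanishing continuous function on the
plane that equals `(z - p) ^ m` outside `X`. -/
theorem eq_zero_of_hasLogOn_zpow_mul {K : Set ℂ} (hK : IsClosed K) {p : ℂ} (hp : p ∉ K)
    (hb : Bornology.IsBounded (connectedComponentIn Kᶜ p)) {m : ℤ} {r : ℂ → ℂ}
    (hr : ContinuousOn r (closure (connectedComponentIn Kᶜ p)))
    (hr0 : ∀ z ∈ closure (connectedComponentIn Kᶜ p), r z ≠ 0)
    (h : HasLogOn (fun z => (z - p) ^ m * r z) K) : m = 0 := by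
  classical
  set X := connectedComponentIn Kᶜ p with hX
  have hXo : IsOpen X := hK.isOpen_compl.connectedComponentIn
  have hpX : p ∈ X := mem_connectedComponentIn hp
  obtain ⟨g, hg, hexp⟩ := h
  obtain ⟨g', hg'⟩ := ContinuousMap.exists_restrict_eq hK
    ⟨K.domRestrict g, continuousOn_iff_continuous_domRestrict.mp hg⟩
  have hgg : ∀ z ∈ K, g' z = g z := fun z hz => congrArg (fun f => f ⟨z, hz⟩) hg'
  let F : ℂ → ℂ := fun z => if z ∈ X then Complex.exp (g' z) / r z else (z - p) ^ m
  have hF1 : ∀ z ∈ closure X, F z = Complex.exp (g' z) / r z := by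
    intro z hz
    by_cases hzX : z ∈ X
    · simp only [F, if_pos hzX]
    · have hzK : z ∈ K := frontier_connectedComponentIn_subset hK p
        ⟨hz, fun h => hzX (interior_subset h)⟩
      simp only [F, if_neg hzX]
      rw [hgg z hzK, hexp z hzK, mul_div_cancel_right₀ _ (hr0 z hz)]
  have hF2 : ∀ z ∈ Xᶜ, F z = (z - p) ^ m := fun z hz => if_neg hz
  have hne : ∀ z ∈ Xᶜ, z - p ≠ 0 := fun z hz h0 => hz (sub_eq_zero.1 h0 ▸ hpX)
  have hFc : Continuous F := by
    rw [← continuousOn_univ]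
    have : (Set.univ : Set ℂ) = closure X ∪ Xᶜ := by
      refine (Set.eq_univ_of_forall fun z => ?_).symm
      by_cases hz : z ∈ X
      · exact Or.inl (subset_closure hz)
      · exact Or.inr hz
    rw [this]
    refine ContinuousOn.union_of_isClosed ?_ ?_ isClosed_closure hXo.isClosed_compl
    · refine ContinuousOn.congr ?_ hF1
      exact ContinuousOn.div (by fun_prop) hr hr0
    · refine ContinuousOn.congr ?_ hF2
      exact ContinuousOn.zpow₀ (by fun_prop) m fun z hz => Or.inl (hne z hz)
  have hF0 : ∀ z, F z ≠ 0 := by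
    intro z
    by_cases hz : z ∈ X
    · rw [hF1 z (subset_closure hz)]
      exact div_ne_zero (Complex.exp_ne_zero _) (hr0 z (subset_closure hz))
    · rw [hF2 z hz]
      exact zpow_ne_zero m (hne z hz)
  obtain ⟨R, hR⟩ := hb.subset_closedBall p
  refine eq_zero_of_eq_zpow hFc hF0 (p := p) (R := R) fun z hz => hF2 z fun hzX => ?_
  have := hR hzX
  rw [Metric.mem_closedBall, dist_eq_norm] at this
  linarith

/-- The complement of a bounded set contains a connected neighbourhood of infinity: the image of a
half-plane under the exponential function. -/
theorem exists_isPreconnected_subset_compl {K : Set ℂ} (hK : Bornology.IsBounded K) :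
    ∃ R : ℝ, 0 < R ∧ ∃ S ⊆ Kᶜ, IsPreconnected S ∧ ∀ z : ℂ, R ≤ ‖z‖ → z ∈ S := by
  obtain ⟨R, hR0, hR⟩ := hK.subset_ball_lt 0 0
  refine ⟨R, hR0, Complex.exp '' {w | Real.log R ≤ w.re}, ?_,
    (convex_halfSpace_re_ge _).isPreconnected.image _ Complex.continuous_exp.continuousOn, ?_⟩
  · rintro _ ⟨w, hw, rfl⟩ hwK
    have h1 := hR hwK
    rw [Metric.mem_ball, dist_zero_right, Complex.norm_exp] at h1
    have h2 := Real.exp_le_exp.2 (show Real.log R ≤ w.re from hw)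
    rw [Real.exp_log hR0] at h2
    linarith
  · intro z hz
    have hz0 : z ≠ 0 := norm_pos_iff.1 (hR0.trans_le hz)
    refine ⟨Complex.log z, ?_, Complex.exp_log hz0⟩
    simp only [Set.mem_ofPred_eq, Complex.log_re]
    exact Real.log_le_log hR0 hz

/-- The complement of a bounded set has at most one unbounded component. -/
theorem connectedComponentIn_eq_of_not_isBounded {K : Set ℂ} (hK : Bornology.IsBounded K) {p q : ℂ}
    (hp : ¬ Bornology.IsBounded (connectedComponentIn Kᶜ p))
    (hq : ¬ Bornology.IsBounded (connectedComponentIn Kᶜ q)) :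
    connectedComponentIn Kᶜ p = connectedComponentIn Kᶜ q := by
  obtain ⟨R, hR0, S, hSK, hSc, hSmem⟩ := exists_isPreconnected_subset_compl hK
  have key : ∀ x, ¬ Bornology.IsBounded (connectedComponentIn Kᶜ x) →
      connectedComponentIn Kᶜ x = connectedComponentIn Kᶜ (R : ℂ) := by
    intro x hx
    have : ∃ z ∈ connectedComponentIn Kᶜ x, R ≤ ‖z‖ := by
      by_contra hcon
      push Not at hcon
      exact hx (Metric.isBounded_ball.subset fun z hz => by
        rw [Metric.mem_ball, dist_zero_right]
        exact hcon z hz)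
    obtain ⟨z, hz, hzR⟩ := this
    rw [connectedComponentIn_eq hz]
    have hRS : (R : ℂ) ∈ S := hSmem _ (by rw [Complex.norm_real, Real.norm_of_nonneg hR0.le])
    exact connectedComponentIn_eq (hSc.subset_connectedComponentIn (hSmem z hzR) hSK hRS)
  rw [key p hp, key q hq]

theorem exists_not_isBounded_connectedComponentIn {K : Set ℂ} (hK : Bornology.IsBounded K) :
    ∃ p ∈ Kᶜ, ¬ Bornology.IsBounded (connectedComponentIn Kᶜ p) := by
  obtain ⟨R, hR0, S, hSK, hSc, hSmem⟩ := exists_isPreconnected_subset_compl hK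
  have hRS : (R : ℂ) ∈ S := hSmem _ (by rw [Complex.norm_real, Real.norm_of_nonneg hR0.le])
  refine ⟨R, hSK hRS, fun hb => ?_⟩
  obtain ⟨r, hr0, hr⟩ := hb.subset_ball_lt 0 0
  have hnorm : ‖((R + r : ℝ) : ℂ)‖ = R + r := by
    rw [Complex.norm_real, Real.norm_of_nonneg (by positivity)]
  have := hr (hSc.subset_connectedComponentIn hRS hSK
    (hSmem ((R + r : ℝ) : ℂ) (by rw [hnorm]; linarith)))
  rw [Metric.mem_ball, dist_zero_right, hnorm] at this
  linarith

theorem notMem_closure_connectedComponentIn {K : Set ℂ} (hK : IsClosed K) {p q : ℂ} (hq : q ∉ K)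
    (hpq : q ∉ connectedComponentIn Kᶜ p) : q ∉ closure (connectedComponentIn Kᶜ p) := by
  intro h
  by_cases hi : q ∈ interior (connectedComponentIn Kᶜ p)
  · exact hpq (interior_subset hi)
  · exact hq (frontier_connectedComponentIn_subset hK p ⟨h, hi⟩)

/-- The converse of `hasLogOn_div_of_isPreconnected`: if `(z - p) / (z - q)` has a continuous
logarithm on the compact set `K`, then `K` does not separate `p` and `q`. -/
theorem mem_connectedComponentIn_of_hasLogOn {K : Set ℂ} (hK : IsCompact K) {p q : ℂ} (hp : p ∉ K)
    (hq : q ∉ K) (h : HasLogOn (fun z => (z - p) / (z - q)) K) :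
    q ∈ connectedComponentIn Kᶜ p := by
  by_contra hpq
  have hqp : p ∉ connectedComponentIn Kᶜ q := fun h' => hpq (by
    rw [← connectedComponentIn_eq h']
    exact mem_connectedComponentIn hq)
  have key : ∀ p q : ℂ, p ∉ K → q ∉ K → q ∉ connectedComponentIn Kᶜ p →
      HasLogOn (fun z => (z - p) / (z - q)) K →
      ¬ Bornology.IsBounded (connectedComponentIn Kᶜ p) := by
    intro p q hp hq hpq h hb
    have hne : ∀ z ∈ closure (connectedComponentIn Kᶜ p), z - q ≠ 0 := fun z hz h0 =>
      notMem_closure_connectedComponentIn hK.isClosed hq hpq (sub_eq_zero.1 h0 ▸ hz)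
    have := eq_zero_of_hasLogOn_zpow_mul hK.isClosed hp hb (m := 1) (r := fun z => (z - q)⁻¹)
      (ContinuousOn.inv₀ (by fun_prop) hne) (fun z hz => inv_ne_zero (hne z hz))
      (h.congr fun z _ => by rw [zpow_one, div_eq_mul_inv])
    exact one_ne_zero this
  have h1 := key p q hp hq hpq h
  have h2 := key q p hq hp hqp (h.inv.congr fun z _ => by rw [inv_div])
  rw [connectedComponentIn_eq_of_not_isBounded hK.isBounded h1 h2] at hpq
  exact hpq (mem_connectedComponentIn hq)

/-! ### Logarithms on unions and on arcs -/

/-- A function on the image of a compact set is continuous if its composition with the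
parametrization is. -/
theorem continuousOn_image_of_comp {S : Set ℝ} (hS : IsCompact S) {γ : ℝ → ℂ}
    (hγ : ContinuousOn γ S) {g : ℂ → ℂ} (hg : ContinuousOn (g ∘ γ) S) :
    ContinuousOn g (γ '' S) := by
  rw [continuousOn_iff_isClosed]
  intro C hC
  obtain ⟨u, hu, huC⟩ := continuousOn_iff_isClosed.1 hg C hC
  refine ⟨γ '' (u ∩ S), ((hS.inter_left hu).image_of_continuousOn
    (hγ.mono Set.inter_subset_right)).isClosed, ?_⟩
  ext z
  constructor
  · rintro ⟨hz, t, ht, rfl⟩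
    have : t ∈ g ∘ γ ⁻¹' C ∩ S := ⟨hz, ht⟩
    rw [huC] at this
    exact ⟨⟨t, this, rfl⟩, t, ht, rfl⟩
  · rintro ⟨⟨t, ht, rfl⟩, hz⟩
    rw [← huC] at ht
    exact ⟨ht.1, hz⟩

/-- A compact part of an injective arc carries a continuous logarithm of every nonvanishing
function. -/
theorem hasLogOn_image_of_injOn {a b : ℝ} (hab : a ≤ b) {γ : ℝ → ℂ}
    (hγ : ContinuousOn γ (Set.Icc a b)) {S : Set ℝ} (hS : IsCompact S) (hS1 : S ⊆ Set.Icc a b)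
    (hinj : Set.InjOn γ S) {h : ℂ → ℂ} (hh : ContinuousOn h (γ '' Set.Icc a b))
    (h0 : ∀ z ∈ γ '' Set.Icc a b, h z ≠ 0) : HasLogOn h (γ '' S) := by
  obtain ⟨ψ, hψ, hexp⟩ := exists_log_Icc hab (u := h ∘ γ) (hh.comp hγ (Set.mapsTo_image _ _))
    (fun t ht => h0 _ (Set.mem_image_of_mem _ ht))
  have hinv : ∀ t ∈ S, Function.invFunOn γ S (γ t) = t := fun t ht => hinj.leftInvOn_invFunOn ht
  refine ⟨ψ ∘ Function.invFunOn γ S, continuousOn_image_of_comp hS (hγ.mono hS1) ?_, ?_⟩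
  · refine (hψ.mono hS1).congr fun t ht => ?_
    simp only [Function.comp, hinv t ht]
  · rintro _ ⟨t, ht, rfl⟩
    simp only [Function.comp, hinv t ht]
    exact hexp t (hS1 ht)

/-- Continuous logarithms on two closed sets with connected intersection can be glued. -/
theorem HasLogOn.union {h : ℂ → ℂ} {A B : Set ℂ} (hA : IsClosed A) (hB : IsClosed B)
    (hAB : IsPreconnected (A ∩ B)) (hhA : HasLogOn h A) (hhB : HasLogOn h B) :
    HasLogOn h (A ∪ B) := by
  classical
  obtain ⟨f, hf, hfe⟩ := hhA
  obtain ⟨g, hg, hge⟩ := hhB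
  obtain ⟨n, hn⟩ := exists_int_sub_eq_of_exp_eq hAB (hf.mono Set.inter_subset_left)
    (hg.mono Set.inter_subset_right) (fun z hz => by rw [hfe z hz.1, hge z hz.2])
  let F : ℂ → ℂ := fun z => if z ∈ A then f z else g z + n * (2 * Real.pi * Complex.I)
  have hFA : ∀ z ∈ A, F z = f z := fun z hz => if_pos hz
  have hFB : ∀ z ∈ B, F z = g z + n * (2 * Real.pi * Complex.I) := fun z hz => by
    by_cases hzA : z ∈ A
    · rw [hFA z hzA, hn z ⟨hzA, hz⟩]
    · exact if_neg hzA
  refine ⟨F, ContinuousOn.union_of_isClosed (hf.congr hFA)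
    ((hg.add continuousOn_const).congr hFB) hA hB, ?_⟩
  rintro z (hz | hz)
  · rw [hFA z hz, hfe z hz]
  · rw [hFB z hz, Complex.exp_add, Complex.exp_int_mul_two_pi_mul_I, mul_one, hge z hz]

/-- An arc `γ` attached to the closed set `K`: its ends lie in `K`, its interior is simple and
disjoint from `K`.  The two ends may coincide. -/
structure IsAttachedArc (K : Set ℂ) (γ : ℝ → ℂ) : Prop where
  continuousOn : ContinuousOn γ (Set.Icc 0 1)
  injOn : Set.InjOn γ (Set.Ioo 0 1)
  notMem : ∀ t ∈ Set.Ioo (0 : ℝ) 1, γ t ∉ K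
  zero_mem : γ 0 ∈ K
  one_mem : γ 1 ∈ K

namespace IsAttachedArc

variable {K : Set ℂ} {γ : ℝ → ℂ} {h : ℂ → ℂ}

theorem isCompact_image (hγ : IsAttachedArc K γ) : IsCompact (γ '' Set.Icc 0 1) :=
  isCompact_Icc.image_of_continuousOn hγ.continuousOn

theorem eq_of_eq (hγ : IsAttachedArc K γ) {s t : ℝ} (hs : s ∈ Set.Ioo (0 : ℝ) 1)
    (ht : t ∈ Set.Icc (0 : ℝ) 1) (hst : γ t = γ s) : t = s := by
  refine hγ.injOn ⟨lt_of_le_of_ne ht.1 ?_, lt_of_le_of_ne ht.2 ?_⟩ hs hst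
  · rintro rfl
    exact hγ.notMem s hs (hst ▸ hγ.zero_mem)
  · rintro rfl
    exact hγ.notMem s hs (hst ▸ hγ.one_mem)

/-- A logarithm `φ` on `K` and a logarithm `ψ` along the arc can be glued if their differences at
the two ends of the arc agree. -/
theorem hasLogOn_union (hγ : IsAttachedArc K γ) (hK : IsClosed K) {φ : ℂ → ℂ}
    (hφ : ContinuousOn φ K) (hφe : ∀ z ∈ K, Complex.exp (φ z) = h z) {ψ : ℝ → ℂ}
    (hψ : ContinuousOn ψ (Set.Icc 0 1))
    (hψe : ∀ t ∈ Set.Icc (0 : ℝ) 1, Complex.exp (ψ t) = h (γ t))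
    (hjump : ψ 1 - φ (γ 1) = ψ 0 - φ (γ 0)) : HasLogOn h (K ∪ γ '' Set.Icc 0 1) := by
  classical
  have h01 : (0 : ℝ) ∈ Set.Icc (0 : ℝ) 1 := ⟨le_rfl, zero_le_one⟩
  have h11 : (1 : ℝ) ∈ Set.Icc (0 : ℝ) 1 := ⟨zero_le_one, le_rfl⟩
  let c := ψ 0 - φ (γ 0)
  have hc : Complex.exp c = 1 := by
    have : h (γ 0) ≠ 0 := by
      rw [← hφe _ hγ.zero_mem]
      exact Complex.exp_ne_zero _
    rw [Complex.exp_sub, hψe 0 h01, hφe _ hγ.zero_mem, div_self this]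
  let F : ℂ → ℂ := fun z => if z ∈ K then φ z + c else ψ (Function.invFunOn γ (Set.Icc 0 1) z)
  have hFK : ∀ z ∈ K, F z = φ z + c := fun z hz => if_pos hz
  have hFγ : ∀ t ∈ Set.Icc (0 : ℝ) 1, F (γ t) = ψ t := by
    intro t ht
    rcases eq_or_lt_of_le ht.1 with rfl | ht0
    · rw [hFK _ hγ.zero_mem]
      simp [c]
    rcases eq_or_lt_of_le ht.2 with rfl | ht1
    · rw [hFK _ hγ.one_mem]
      simp only [c]
      linear_combination -hjump
    · simp only [F, if_neg (hγ.notMem t ⟨ht0, ht1⟩)]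
      have hex : ∃ s ∈ Set.Icc (0 : ℝ) 1, γ s = γ t := ⟨t, ht, rfl⟩
      rw [hγ.eq_of_eq ⟨ht0, ht1⟩ (Function.invFunOn_mem hex) (Function.invFunOn_eq hex)]
  refine ⟨F, ContinuousOn.union_of_isClosed ((hφ.add continuousOn_const).congr hFK)
    (continuousOn_image_of_comp isCompact_Icc hγ.continuousOn (hψ.congr hFγ)) hK
    hγ.isCompact_image.isClosed, ?_⟩
  rintro z (hz | ⟨t, ht, rfl⟩)
  · rw [hFK z hz, Complex.exp_add, hc, mul_one, hφe z hz]
  · rw [hFγ t ht, hψe t ht]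

/-- The differences of a logarithm on `K` and a logarithm along the arc at the two ends of the arc
differ by a multiple of `2πi`. -/
theorem exists_jump (hγ : IsAttachedArc K γ) {φ : ℂ → ℂ}
    (hφe : ∀ z ∈ K, Complex.exp (φ z) = h z) {ψ : ℝ → ℂ}
    (hψe : ∀ t ∈ Set.Icc (0 : ℝ) 1, Complex.exp (ψ t) = h (γ t)) :
    ∃ n : ℤ, ψ 1 - φ (γ 1) = ψ 0 - φ (γ 0) + n * (2 * Real.pi * Complex.I) := by
  rw [← Complex.exp_eq_exp_iff_exists_int, Complex.exp_sub, Complex.exp_sub,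
    hψe 0 ⟨le_rfl, zero_le_one⟩, hψe 1 ⟨zero_le_one, le_rfl⟩, hφe _ hγ.zero_mem,
    hφe _ hγ.one_mem]
  have h0 : h (γ 0) ≠ 0 := hφe _ hγ.zero_mem ▸ Complex.exp_ne_zero _
  have h1 : h (γ 1) ≠ 0 := hφe _ hγ.one_mem ▸ Complex.exp_ne_zero _
  rw [div_self h0, div_self h1]

/-- If the ends of the arc lie in a connected subset `L` of `K`, then the obstruction against
gluing logarithms on `K` and on the arc is already seen on `L` and the arc. -/
theorem hasLogOn_union_of_isPreconnected (hγ : IsAttachedArc K γ) (hK : IsClosed K) {L : Set ℂ}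
    (hLK : L ⊆ K) (hL : IsPreconnected L) (h0 : γ 0 ∈ L) (h1 : γ 1 ∈ L) (hhK : HasLogOn h K)
    (hhL : HasLogOn h (L ∪ γ '' Set.Icc 0 1)) : HasLogOn h (K ∪ γ '' Set.Icc 0 1) := by
  obtain ⟨φ, hφ, hφe⟩ := hhK
  obtain ⟨χ, hχ, hχe⟩ := hhL
  obtain ⟨n, hn⟩ := exists_int_sub_eq_of_exp_eq hL (hχ.mono Set.subset_union_left)
    (hφ.mono hLK) (fun z hz => by rw [hχe z (Or.inl hz), hφe z (hLK hz)])
  refine hγ.hasLogOn_union hK hφ hφe (ψ := χ ∘ γ)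
    (hχ.comp hγ.continuousOn fun t ht => Or.inr ⟨t, ht, rfl⟩)
    (fun t ht => hχe _ (Or.inr ⟨t, ht, rfl⟩)) ?_
  simp only [Function.comp, hn _ h0, hn _ h1]
  ring

/-! ### Attaching an arc to a compact set -/

/-- Attaching an arc splits a component of the complement into at most two components. -/
theorem two_components (hγ : IsAttachedArc K γ) (hK : IsCompact K) {U : Set ℂ}
    (hU : IsPreconnected U) (hUK : U ⊆ Kᶜ) {p₁ p₂ p₃ : ℂ} (h₁ : p₁ ∈ U \ γ '' Set.Icc 0 1)
    (h₂ : p₂ ∈ U \ γ '' Set.Icc 0 1) (h₃ : p₃ ∈ U \ γ '' Set.Icc 0 1) :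
    p₂ ∈ connectedComponentIn (K ∪ γ '' Set.Icc 0 1)ᶜ p₁ ∨
    p₃ ∈ connectedComponentIn (K ∪ γ '' Set.Icc 0 1)ᶜ p₁ ∨
    p₃ ∈ connectedComponentIn (K ∪ γ '' Set.Icc 0 1)ᶜ p₂ := by
  set f := γ '' Set.Icc 0 1 with hf
  have hc : IsCompact (K ∪ f) := hK.union hγ.isCompact_image
  have hn : ∀ {p}, p ∈ U \ f → p ∉ K ∪ f := by
    rintro p ⟨hp1, hp2⟩ (h | h)
    exacts [hUK hp1 h, hp2 h]
  have hne : ∀ {p}, p ∈ U \ f → ∀ z ∈ K ∪ f, z - p ≠ 0 := fun hp z hz h0 =>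
    hn hp (sub_eq_zero.1 h0 ▸ hz)
  obtain ⟨φ₂, hφ₂, hφe₂⟩ := hasLogOn_div_of_isPreconnected hK.isClosed hU hUK h₁.1 h₂.1
  obtain ⟨φ₃, hφ₃, hφe₃⟩ := hasLogOn_div_of_isPreconnected hK.isClosed hU hUK h₁.1 h₃.1
  have hψ : ∀ {p q}, p ∈ U \ f → q ∈ U \ f → ∃ ψ : ℝ → ℂ, ContinuousOn ψ (Set.Icc 0 1) ∧
      ∀ t ∈ Set.Icc (0 : ℝ) 1, Complex.exp (ψ t) = (γ t - p) / (γ t - q) := by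
    intro p q hp hq
    have hmem : ∀ t ∈ Set.Icc (0 : ℝ) 1, γ t ∈ K ∪ f := fun t ht => Or.inr ⟨t, ht, rfl⟩
    exact exists_log_Icc zero_le_one
      ((hγ.continuousOn.sub continuousOn_const).div (hγ.continuousOn.sub continuousOn_const)
        fun t ht => hne hq _ (hmem t ht))
      fun t ht => div_ne_zero (hne hp _ (hmem t ht)) (hne hq _ (hmem t ht))
  obtain ⟨ψ₂, hψ₂, hψe₂⟩ := hψ h₁ h₂
  obtain ⟨ψ₃, hψ₃, hψe₃⟩ := hψ h₁ h₃
  obtain ⟨a, ha⟩ := hγ.exists_jump (h := fun z => (z - p₁) / (z - p₂)) hφe₂ hψe₂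
  obtain ⟨b, hb⟩ := hγ.exists_jump (h := fun z => (z - p₁) / (z - p₃)) hφe₃ hψe₃
  -- The jumps cancel in the combination with exponents `b` and `-a`.
  have hlog : HasLogOn (fun z => ((z - p₁) / (z - p₂)) ^ b * ((z - p₁) / (z - p₃)) ^ (-a))
      (K ∪ f) := by
    refine hγ.hasLogOn_union hK.isClosed (φ := fun z => b * φ₂ z + (-a : ℤ) * φ₃ z)
      (ψ := fun t => b * ψ₂ t + (-a : ℤ) * ψ₃ t) (by fun_prop) ?_ (by fun_prop) ?_ ?_
    · intro z hz
      rw [Complex.exp_add, Complex.exp_int_mul, Complex.exp_int_mul, hφe₂ z hz, hφe₃ z hz]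
    · intro t ht
      rw [Complex.exp_add, Complex.exp_int_mul, Complex.exp_int_mul, hψe₂ t ht, hψe₃ t ht]
    · push_cast
      linear_combination (b : ℂ) * ha - a * hb
  by_contra hcon
  push Not at hcon
  obtain ⟨h12, h13, h23⟩ := hcon
  have hsymm : ∀ {p q}, p ∈ U \ f → q ∈ U \ f → q ∉ connectedComponentIn (K ∪ f)ᶜ p →
      p ∉ connectedComponentIn (K ∪ f)ᶜ q := fun hp hq h h' => h (by
    rw [← connectedComponentIn_eq h']
    exact mem_connectedComponentIn (hn hq))
  have hcl : ∀ {p q}, q ∈ U \ f → q ∉ connectedComponentIn (K ∪ f)ᶜ p →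
      ∀ z ∈ closure (connectedComponentIn (K ∪ f)ᶜ p), z - q ≠ 0 := fun hq h z hz h0 =>
    notMem_closure_connectedComponentIn hc.isClosed (hn hq) h (sub_eq_zero.1 h0 ▸ hz)
  have ha0 : a ≠ 0 := by
    rintro rfl
    exact h12 (mem_connectedComponentIn_of_hasLogOn hc (hn h₁) (hn h₂)
      (hγ.hasLogOn_union hK.isClosed hφ₂ hφe₂ hψ₂ hψe₂ (by simpa using ha)))
  have hb0 : b ≠ 0 := by
    rintro rfl
    exact h13 (mem_connectedComponentIn_of_hasLogOn hc (hn h₁) (hn h₃)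
      (hγ.hasLogOn_union hK.isClosed hφ₃ hφe₃ hψ₃ hψe₃ (by simpa using hb)))
  have hab : b - a ≠ 0 := by
    intro hba
    have hba' : (b : ℂ) = a := by exact_mod_cast sub_eq_zero.1 hba
    refine h23 (mem_connectedComponentIn_of_hasLogOn hc (hn h₂) (hn h₃) ?_)
    refine hγ.hasLogOn_union hK.isClosed (φ := fun z => φ₃ z - φ₂ z)
      (ψ := fun t => ψ₃ t - ψ₂ t) (hφ₃.sub hφ₂) ?_ (hψ₃.sub hψ₂) ?_ ?_
    · intro z hz
      rw [Complex.exp_sub, hφe₂ z hz, hφe₃ z hz]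
      have := hne h₁ z (Or.inl hz)
      have := hne h₂ z (Or.inl hz)
      have := hne h₃ z (Or.inl hz)
      field_simp
    · intro t ht
      rw [Complex.exp_sub, hψe₂ t ht, hψe₃ t ht]
      have := hne h₁ (γ t) (Or.inr ⟨t, ht, rfl⟩)
      have := hne h₂ (γ t) (Or.inr ⟨t, ht, rfl⟩)
      have := hne h₃ (γ t) (Or.inr ⟨t, ht, rfl⟩)
      field_simp
    · linear_combination hb - ha + (2 * Real.pi * Complex.I) * hba'
  have hlog' : HasLogOn (fun z => (z - p₁) ^ (b - a) * ((z - p₂) ^ (-b) * (z - p₃) ^ a))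
      (K ∪ f) := by
    refine hlog.congr fun z hz => ?_
    have hz1 := hne h₁ z hz
    rw [div_zpow, div_zpow, zpow_sub₀ hz1, zpow_neg, zpow_neg, zpow_neg]
    have := zpow_ne_zero a hz1
    have := zpow_ne_zero b hz1
    have := zpow_ne_zero b (hne h₂ z hz)
    have := zpow_ne_zero a (hne h₃ z hz)
    field_simp
  -- At least one of the components of `p₁` and `p₂` is bounded.
  by_cases hb1 : Bornology.IsBounded (connectedComponentIn (K ∪ f)ᶜ p₁)
  · have h2 := hcl h₂ h12
    have h3 := hcl h₃ h13
    refine hab (eq_zero_of_hasLogOn_zpow_mul hc.isClosed (hn h₁) hb1 ?_ ?_ hlog')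
    · exact (ContinuousOn.zpow₀ (by fun_prop) _ fun z hz => Or.inl (h2 z hz)).mul
        (ContinuousOn.zpow₀ (by fun_prop) _ fun z hz => Or.inl (h3 z hz))
    · exact fun z hz => mul_ne_zero (zpow_ne_zero _ (h2 z hz)) (zpow_ne_zero _ (h3 z hz))
  by_cases hb2 : Bornology.IsBounded (connectedComponentIn (K ∪ f)ᶜ p₂)
  · have h1 := hcl h₁ (hsymm h₁ h₂ h12)
    have h3 := hcl h₃ h23
    refine hb0 (neg_eq_zero.1 (eq_zero_of_hasLogOn_zpow_mul hc.isClosed (hn h₂) hb2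
      (r := fun z => (z - p₁) ^ (b - a) * (z - p₃) ^ a) ?_ ?_ (hlog'.congr fun z _ => by ring)))
    · exact (ContinuousOn.zpow₀ (by fun_prop) _ fun z hz => Or.inl (h1 z hz)).mul
        (ContinuousOn.zpow₀ (by fun_prop) _ fun z hz => Or.inl (h3 z hz))
    · exact fun z hz => mul_ne_zero (zpow_ne_zero _ (h1 z hz)) (zpow_ne_zero _ (h3 z hz))
  · rw [connectedComponentIn_eq_of_not_isBounded hc.isBounded hb1 hb2] at h12
    exact h12 (mem_connectedComponentIn (hn h₂))

/-- If an arc is attached to `K` inside a component of the complement of `K`, then the whole arc is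
contained in the boundary of each of the components arising from it: two subarcs with only one end
in `K` do not separate anything. -/
theorem image_subset_frontier (hγ : IsAttachedArc K γ) (hK : IsCompact K) {U : Set ℂ}
    (hU : IsPreconnected U) (hUK : U ⊆ Kᶜ) (hγU : γ '' Set.Ioo 0 1 ⊆ U) {p : ℂ}
    (hp : p ∈ U \ γ '' Set.Icc 0 1) :
    γ '' Set.Icc 0 1 ⊆ frontier (connectedComponentIn (K ∪ γ '' Set.Icc 0 1)ᶜ p) := by
  set f := γ '' Set.Icc 0 1 with hf
  set X := connectedComponentIn (K ∪ f)ᶜ p with hX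
  have hpKf : p ∉ K ∪ f := by
    rintro (h | h)
    exacts [hUK hp.1 h, hp.2 h]
  have hc : IsCompact (K ∪ f) := hK.union hγ.isCompact_image
  have hXo : IsOpen X := hc.isClosed.isOpen_compl.connectedComponentIn
  have hpX : p ∈ X := mem_connectedComponentIn hpKf
  -- It suffices to consider interior points of the arc.
  suffices hsuff : ∀ t ∈ Set.Ioo (0 : ℝ) 1, γ t ∈ frontier X by
    have hcl : ContinuousOn γ (closure (Set.Ioo (0 : ℝ) 1)) := by
      rw [closure_Ioo zero_ne_one]
      exact hγ.continuousOn
    have h2 := hcl.image_closure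
    rw [closure_Ioo zero_ne_one] at h2
    refine h2.trans (closure_minimal ?_ isClosed_frontier)
    rintro _ ⟨t, ht, rfl⟩
    exact hsuff t ht
  intro s hs
  by_contra hsX
  -- A subinterval `[s₁, s₂]` around `s` that does not meet the boundary of `X`.
  have hcs : ContinuousAt γ s := (hγ.continuousOn s (Set.Ioo_subset_Icc_self hs)).continuousAt
    (Icc_mem_nhds hs.1 hs.2)
  have hev : ∀ᶠ t in nhds s, γ t ∉ frontier X ∧ t ∈ Set.Ioo (0 : ℝ) 1 :=
    (hcs.eventually (isClosed_frontier.isOpen_compl.mem_nhds hsX)).and (Ioo_mem_nhds hs.1 hs.2)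
  obtain ⟨ε, hε, hball⟩ := Metric.eventually_nhds_iff.1 hev
  have hnear : ∀ t, |t - s| < ε → γ t ∉ frontier X ∧ t ∈ Set.Ioo (0 : ℝ) 1 := fun t ht =>
    hball (by rwa [Real.dist_eq])
  set s₁ := s - ε / 2 with hs₁
  set s₂ := s + ε / 2 with hs₂
  have hs₁m : s₁ ∈ Set.Ioo (0 : ℝ) 1 := (hnear s₁ (by
    rw [hs₁, abs_lt]
    constructor <;> linarith)).2
  have hs₂m : s₂ ∈ Set.Ioo (0 : ℝ) 1 := (hnear s₂ (by
    rw [hs₂, abs_lt]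
    constructor <;> linarith)).2
  have hsub₁ : Set.Icc 0 s₁ ⊆ Set.Icc (0 : ℝ) 1 := Set.Icc_subset_Icc_right hs₁m.2.le
  have hsub₂ : Set.Icc s₂ 1 ⊆ Set.Icc (0 : ℝ) 1 := Set.Icc_subset_Icc_left hs₂m.1.le
  set f₁ := γ '' Set.Icc 0 s₁ with hf₁
  set f₂ := γ '' Set.Icc s₂ 1 with hf₂
  have hf₁c : IsCompact f₁ := isCompact_Icc.image_of_continuousOn (hγ.continuousOn.mono hsub₁)
  have hf₂c : IsCompact f₂ := isCompact_Icc.image_of_continuousOn (hγ.continuousOn.mono hsub₂)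
  have hf₁f : f₁ ⊆ f := Set.image_mono hsub₁
  have hf₂f : f₂ ⊆ f := Set.image_mono hsub₂
  have hq1 : γ s ∉ f₁ := by
    rintro ⟨t, ht, hts⟩
    have := hγ.eq_of_eq hs (hsub₁ ht) hts
    have := ht.2
    linarith
  have hq2 : γ s ∉ f₂ := by
    rintro ⟨t, ht, hts⟩
    have := hγ.eq_of_eq hs (hsub₂ ht) hts
    have := ht.1
    linarith
  have hqU : γ s ∈ U := hγU ⟨s, hs, rfl⟩
  have hqf : γ s ∈ f := ⟨s, Set.Ioo_subset_Icc_self hs, rfl⟩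
  -- The function `h` detecting whether `p` and `γ s` are separated.
  set h : ℂ → ℂ := fun z => (z - p) / (z - γ s) with hh
  have hlogK : HasLogOn h K :=
    hasLogOn_div_of_isPreconnected hK.isClosed hU hUK hp.1 hqU
  have harc : ∀ a b : ℝ, a ≤ b → Set.Icc a b ⊆ Set.Icc 0 1 → γ s ∉ γ '' Set.Icc a b →
      Set.InjOn γ (Set.Icc a b) → HasLogOn h (γ '' Set.Icc a b) := by
    intro a b hab hsub hns hinj
    have hne : ∀ z ∈ γ '' Set.Icc a b, z - γ s ≠ 0 := fun z hz h0 =>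
      hns (sub_eq_zero.1 h0 ▸ hz)
    refine hasLogOn_image_of_injOn hab (hγ.continuousOn.mono hsub) isCompact_Icc subset_rfl hinj
      (ContinuousOn.div (by fun_prop) (by fun_prop) hne) fun z hz => div_ne_zero ?_ (hne z hz)
    intro h0
    exact hp.2 (sub_eq_zero.1 h0 ▸ Set.image_mono hsub hz)
  have hlog₁ : HasLogOn h f₁ := by
    refine harc 0 s₁ hs₁m.1.le hsub₁ hq1 fun t ht t' ht' htt => ?_
    rcases eq_or_lt_of_le ht.1 with h0 | h0
    · rcases eq_or_lt_of_le ht'.1 with h0' | h0'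
      · rw [← h0, ← h0']
      · exact hγ.eq_of_eq ⟨h0', ht'.2.trans_lt hs₁m.2⟩ (hsub₁ ht) htt
    · exact (hγ.eq_of_eq ⟨h0, ht.2.trans_lt hs₁m.2⟩ (hsub₁ ht') htt.symm).symm
  have hlog₂ : HasLogOn h f₂ := by
    refine harc s₂ 1 hs₂m.2.le hsub₂ hq2 fun t ht t' ht' htt => ?_
    rcases eq_or_lt_of_le ht.2 with h0 | h0
    · rcases eq_or_lt_of_le ht'.2 with h0' | h0'
      · rw [h0, h0']
      · exact hγ.eq_of_eq ⟨hs₂m.1.trans_le ht'.1, h0'⟩ (hsub₂ ht) htt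
    · exact (hγ.eq_of_eq ⟨hs₂m.1.trans_le ht.1, h0⟩ (hsub₂ ht') htt.symm).symm
  have hint₁ : K ∩ f₁ ⊆ {γ 0} := by
    rintro _ ⟨hzK, t, ht, rfl⟩
    rcases eq_or_lt_of_le ht.1 with h0 | h0
    · rw [← h0]
      rfl
    · exact absurd hzK (hγ.notMem t ⟨h0, ht.2.trans_lt hs₁m.2⟩)
  have hint₂ : (K ∪ f₁) ∩ f₂ ⊆ {γ 1} := by
    rintro _ ⟨hz, t, ht, rfl⟩
    rcases eq_or_lt_of_le ht.2 with h0 | h0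
    · rw [h0]
      rfl
    · have htm : t ∈ Set.Ioo (0 : ℝ) 1 := ⟨hs₂m.1.trans_le ht.1, h0⟩
      rcases hz with hz | ⟨t', ht', htt⟩
      · exact absurd hz (hγ.notMem t htm)
      · have h1 := hγ.eq_of_eq htm (hsub₁ ht') htt
        have h2 := ht.1
        have h3 := ht'.2
        linarith
  have hlog : HasLogOn h (K ∪ f₁ ∪ f₂) :=
    HasLogOn.union (hK.isClosed.union hf₁c.isClosed) hf₂c.isClosed
      (Set.subsingleton_singleton.anti hint₂).isPreconnected
      (HasLogOn.union hK.isClosed hf₁c.isClosed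
        (Set.subsingleton_singleton.anti hint₁).isPreconnected hlogK hlog₁) hlog₂
  have hsubKf : K ∪ f₁ ∪ f₂ ⊆ K ∪ f :=
    Set.union_subset (Set.union_subset_union_right _ hf₁f) (hf₂f.trans Set.subset_union_right)
  have hqn : γ s ∉ K ∪ f₁ ∪ f₂ := by
    rintro ((hz | hz) | hz)
    exacts [hUK hqU hz, hq1 hz, hq2 hz]
  have hmem := mem_connectedComponentIn_of_hasLogOn ((hK.union hf₁c).union hf₂c)
    (fun hz => hpKf (hsubKf hz)) hqn hlog
  set Y := connectedComponentIn (K ∪ f₁ ∪ f₂)ᶜ p with hY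
  -- `Y` contains `p` and `γ s`, but no boundary point of `X`.
  have hYX : Y ⊆ X := by
    refine isPreconnected_connectedComponentIn.subset_of_closure_inter_subset hXo
      ⟨p, mem_connectedComponentIn fun hz => hpKf (hsubKf hz), hpX⟩ ?_
    rintro z ⟨hz, hzY⟩
    by_contra hzX
    have hzf : z ∈ frontier X := ⟨hz, by rwa [hXo.interior_eq]⟩
    have hzn : z ∉ K ∪ f₁ ∪ f₂ := connectedComponentIn_subset _ _ hzY
    rcases frontier_connectedComponentIn_subset hc.isClosed p hzf with hzK | ⟨t, ht, rfl⟩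
    · exact hzn (Or.inl (Or.inl hzK))
    · by_cases ht1 : t ≤ s₁
      · exact hzn (Or.inl (Or.inr ⟨t, ⟨ht.1, ht1⟩, rfl⟩))
      by_cases ht2 : s₂ ≤ t
      · exact hzn (Or.inr ⟨t, ⟨ht2, ht.2⟩, rfl⟩)
      · refine (hnear t ?_).1 hzf
        rw [abs_lt]
        constructor <;> linarith
  exact connectedComponentIn_subset _ _ (hYX hmem) (Or.inr hqf)

/-- An arc has no interior points: a small circle contained in it would not separate its centre
from the outside. -/
theorem exists_notMem_image (hγ : IsAttachedArc K γ) {U : Set ℂ} (hU : IsOpen U)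
    (hγU : γ (1 / 2) ∈ U) : ∃ p ∈ U, p ∉ γ '' Set.Icc 0 1 := by
  have hhalf : (1 / 2 : ℝ) ∈ Set.Ioo (0 : ℝ) 1 := by norm_num
  by_contra hcon
  push Not at hcon
  set c := γ (1 / 2) with hcdef
  have hc0 : c ≠ γ 0 := fun h => hγ.notMem _ hhalf (by rw [← hcdef, h]; exact hγ.zero_mem)
  have hc1 : c ≠ γ 1 := fun h => hγ.notMem _ hhalf (by rw [← hcdef, h]; exact hγ.one_mem)
  have hopen : IsOpen (U ∩ ({γ 0}ᶜ ∩ {γ 1}ᶜ)) :=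
    hU.inter (isOpen_compl_singleton.inter isOpen_compl_singleton)
  obtain ⟨ε, hε, hball⟩ := Metric.isOpen_iff.1 hopen c ⟨hγU, hc0, hc1⟩
  obtain ⟨R, hR0, hR⟩ := hγ.isCompact_image.isBounded.subset_ball_lt 0 c
  set C := Metric.sphere c (ε / 2) with hC
  have hCball : C ⊆ Metric.ball c ε := fun z hz => by
    rw [Metric.mem_ball, Metric.mem_sphere.1 hz]
    linarith
  set S := Set.Icc (0 : ℝ) 1 ∩ γ ⁻¹' C with hS
  have hSc : IsCompact S :=
    isCompact_Icc.of_isClosed_subset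
      (hγ.continuousOn.preimage_isClosed_of_isClosed isClosed_Icc Metric.isClosed_sphere)
      Set.inter_subset_left
  have hCS : C = γ '' S := by
    ext z
    constructor
    · intro hz
      obtain ⟨t, ht, rfl⟩ := hcon z (hball (hCball hz)).1
      exact ⟨t, ⟨ht, hz⟩, rfl⟩
    · rintro ⟨t, ht, rfl⟩
      exact ht.2
  have hSo : S ⊆ Set.Ioo 0 1 := by
    rintro t ⟨ht, htC⟩
    have := (hball (hCball htC)).2
    refine ⟨lt_of_le_of_ne ht.1 ?_, lt_of_le_of_ne ht.2 ?_⟩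
    · rintro rfl
      exact this.1 rfl
    · rintro rfl
      exact this.2 rfl
  have hcC : c ∉ C := by
    rw [hC, Metric.mem_sphere, dist_self]
    linarith
  have hhS : (1 / 2 : ℝ) ∉ S := fun h => hcC h.2
  obtain ⟨δ, hδ, hδS⟩ := Metric.isOpen_iff.1 hSc.isClosed.isOpen_compl _ hhS
  set δ' := min (δ / 2) (1 / 4) with hδ'
  have hδ'0 : 0 < δ' := lt_min (half_pos hδ) (by norm_num)
  have hδ'1 : δ' ≤ 1 / 4 := min_le_right _ _
  have hδ'2 : δ' < δ := (min_le_left _ _).trans_lt (half_lt_self hδ)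
  set q : ℂ := c + R with hq
  have hqR : q ∉ Metric.ball c R := by
    rw [Metric.mem_ball, dist_eq_norm, hq, add_sub_cancel_left, Complex.norm_real,
      Real.norm_of_nonneg hR0.le]
    exact lt_irrefl _
  have hqf : q ∉ γ '' Set.Icc 0 1 := fun h => hqR (hR h)
  set h : ℂ → ℂ := fun z => (z - c) / (z - q) with hh
  have hpart : ∀ a b : ℝ, a ≤ b → Set.Icc a b ⊆ Set.Icc 0 1 → (1 / 2 : ℝ) ∉ Set.Icc a b →
      HasLogOn h (γ '' (S ∩ Set.Icc a b)) := by
    intro a b hab hsub hhab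
    have hne : ∀ z ∈ γ '' Set.Icc a b, z - q ≠ 0 := fun z hz h0 =>
      hqf (sub_eq_zero.1 h0 ▸ Set.image_mono hsub hz)
    refine hasLogOn_image_of_injOn hab (hγ.continuousOn.mono hsub) (hSc.inter_right isClosed_Icc)
      Set.inter_subset_right (hγ.injOn.mono (Set.inter_subset_left.trans hSo))
      (ContinuousOn.div (by fun_prop) (by fun_prop) hne) fun z hz => div_ne_zero ?_ (hne z hz)
    obtain ⟨t, ht, rfl⟩ := hz
    intro h0
    exact hhab (hγ.eq_of_eq hhalf (hsub ht) (sub_eq_zero.1 h0) ▸ ht)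
  have hsub₁ : Set.Icc 0 (1 / 2 - δ') ⊆ Set.Icc (0 : ℝ) 1 :=
    Set.Icc_subset_Icc_right (by linarith)
  have hsub₂ : Set.Icc (1 / 2 + δ') 1 ⊆ Set.Icc (0 : ℝ) 1 :=
    Set.Icc_subset_Icc_left (by linarith)
  have hlog₁ := hpart 0 (1 / 2 - δ') (by linarith) hsub₁ fun h => by linarith [h.2]
  have hlog₂ := hpart (1 / 2 + δ') 1 (by linarith) hsub₂ fun h => by linarith [h.1]
  have hcl : ∀ a b : ℝ, IsClosed (γ '' (S ∩ Set.Icc a b)) := fun a b =>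
    ((hSc.inter_right isClosed_Icc).image_of_continuousOn
      (hγ.continuousOn.mono (Set.inter_subset_left.trans Set.inter_subset_left))).isClosed
  have hlog : HasLogOn h C := by
    refine (HasLogOn.union (hcl 0 (1 / 2 - δ')) (hcl (1 / 2 + δ') 1) ?_ hlog₁ hlog₂).mono ?_
    · convert isPreconnected_empty
      rw [Set.eq_empty_iff_forall_notMem]
      rintro _ ⟨⟨t, ht, rfl⟩, t', ht', htt⟩
      have h1 := hγ.eq_of_eq (hSo ht.1) (hsub₂ ht'.2) htt
      have h2 := ht.2.2
      have h3 := ht'.2.1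
      linarith
    · intro z hz
      rw [hCS] at hz
      obtain ⟨t, ht, rfl⟩ := hz
      by_cases ht1 : t ≤ 1 / 2 - δ'
      · exact Or.inl ⟨t, ⟨ht, ht.1.1, ht1⟩, rfl⟩
      by_cases ht2 : 1 / 2 + δ' ≤ t
      · exact Or.inr ⟨t, ⟨ht, ht2, ht.1.2⟩, rfl⟩
      · refine absurd ht (hδS ?_)
        rw [Metric.mem_ball, Real.dist_eq, abs_lt]
        constructor <;> linarith
  have hCf : C ⊆ γ '' Set.Icc 0 1 := by
    rw [hCS]
    exact Set.image_mono Set.inter_subset_left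
  have hmem := mem_connectedComponentIn_of_hasLogOn (isCompact_sphere c (ε / 2)) hcC
    (fun hz => hqf (hCf hz)) hlog
  have hsub : connectedComponentIn Cᶜ c ⊆ Metric.ball c (ε / 2) := by
    refine isPreconnected_connectedComponentIn.subset_of_closure_inter_subset Metric.isOpen_ball
      ⟨c, mem_connectedComponentIn hcC, Metric.mem_ball_self (half_pos hε)⟩ ?_
    rintro z ⟨hz, hzY⟩
    have h1 := Metric.closure_ball_subset_closedBall hz
    have h2 : z ∉ C := connectedComponentIn_subset _ _ hzY
    exact lt_of_le_of_ne h1 h2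
  have hqU : q ∈ Metric.ball c ε := Metric.ball_subset_ball (by linarith) (hsub hmem)
  exact hqf (hcon q (hball hqU).1)

end IsAttachedArc

/-! ### Walks -/

namespace Graph

variable {α β : Type*} {G H : Graph α β}

theorem Walk.left_mem {x y : α} (p : G.Walk x y) : x ∈ V(G) := by
  cases p with
  | nil hx => exact hx
  | cons e h p => exact h.left_mem

theorem Reachable.refl {x : α} (hx : x ∈ V(G)) : G.Reachable x x := ⟨.nil hx⟩

theorem Reachable.left_mem {x y : α} (h : G.Reachable x y) : x ∈ V(G) := h.some.left_mem

theorem IsLink.reachable {e : β} {x y : α} (h : G.IsLink e x y) : G.Reachable x y :=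
  ⟨.cons e h (.nil h.right_mem)⟩

theorem Reachable.trans {x y z : α} (h : G.Reachable x y) (h' : G.Reachable y z) :
    G.Reachable x z := by
  obtain ⟨p⟩ := h
  induction p with
  | nil _ => exact h'
  | cons e hl p ih => exact ⟨.cons e hl (ih h').some⟩

theorem Reachable.symm {x y : α} (h : G.Reachable x y) : G.Reachable y x := by
  obtain ⟨p⟩ := h
  induction p with
  | nil hx => exact .refl hx
  | cons e hl p ih => exact ih.trans hl.symm.reachable

theorem Walk.exists_walk_of_le {x y : α} (p : G.Walk x y) (hGH : G ≤ H) :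
    ∃ q : H.Walk x y, q.support = p.support ∧ q.edges = p.edges := by
  induction p with
  | nil hx => exact ⟨.nil (hGH.vertexSet_mono hx), rfl, rfl⟩
  | cons e hl p ih =>
    obtain ⟨q, hq1, hq2⟩ := ih
    refine ⟨.cons e (hl.mono hGH) q, ?_, ?_⟩
    · rw [Walk.support, Walk.support, hq1]
    · rw [Walk.edges, Walk.edges, hq2]

theorem Walk.mem_support_left {x y : α} (p : G.Walk x y) : x ∈ p.support := by
  cases p with
  | nil hx => exact List.mem_singleton_self _
  | cons e h p => exact List.mem_cons_self

theorem Walk.mem_support_right {x y : α} (p : G.Walk x y) : y ∈ p.support := by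
  induction p with
  | nil hx => exact List.mem_singleton_self _
  | cons e h p ih => exact List.mem_cons_of_mem _ ih

/-- From every vertex of a path there is a path to its end that uses no other edges. -/
theorem Walk.exists_isPath_of_mem_support {x y z : α} (p : G.Walk x y) (hp : p.IsPath)
    (hz : z ∈ p.support) : ∃ q : G.Walk z y, q.IsPath ∧ q.edges ⊆ p.edges := by
  induction p with
  | nil hx =>
    obtain rfl : z = _ := List.mem_singleton.1 hz
    exact ⟨.nil hx, hp, List.Subset.refl _⟩
  | @cons x y w e h p ih =>
    by_cases hzx : z = x
    · subst hzx
      exact ⟨.cons e h p, hp, List.Subset.refl _⟩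
    · obtain ⟨q, hq, hqp⟩ := ih (List.nodup_cons.1 hp).2 ((List.mem_cons.1 hz).resolve_left hzx)
      exact ⟨q, hq, fun f hf => List.mem_cons_of_mem _ (hqp hf)⟩

theorem Walk.exists_isPath {x y : α} (p : G.Walk x y) : ∃ q : G.Walk x y, q.IsPath := by
  induction p with
  | nil hx => exact ⟨.nil hx, List.nodup_singleton _⟩
  | @cons x y z e h p ih =>
    obtain ⟨q, hq⟩ := ih
    by_cases hx : x ∈ q.support
    · obtain ⟨r, hr, -⟩ := q.exists_isPath_of_mem_support hq hx
      exact ⟨r, hr⟩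
    · exact ⟨.cons e h q, List.nodup_cons.2 ⟨hx, hq⟩⟩

/-- The ends of an edge on a walk are vertices of the walk. -/
theorem Walk.mem_support_of_mem_edges {x y u v : α} {e : β} (p : G.Walk x y) (he : e ∈ p.edges)
    (hl : G.IsLink e u v) : u ∈ p.support := by
  induction p with
  | nil hx => exact absurd he List.not_mem_nil
  | cons f h p ih =>
    rcases List.mem_cons.1 he with rfl | he
    · rcases hl.left_eq_or_eq h with rfl | rfl
      · exact List.mem_cons_self
      · exact List.mem_cons_of_mem _ p.mem_support_left
    · exact List.mem_cons_of_mem _ (ih he)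

theorem Walk.IsPath.nodup_edges {x y : α} {p : G.Walk x y} (hp : p.IsPath) : p.edges.Nodup := by
  induction p with
  | nil hx => exact List.nodup_nil
  | cons e h p ih =>
    obtain ⟨h1, h2⟩ := List.nodup_cons.1 hp
    exact List.nodup_cons.2 ⟨fun he => h1 (p.mem_support_of_mem_edges he h), ih h2⟩

/-- In a tree, the ends of an edge are not joined by a walk that avoids this edge. -/
theorem IsTree.not_reachable {T : Graph α β} (hT : T.IsTree) {e : β} {x y : α}
    (h : T.IsLink e x y) (hH : H ≤ T) (heH : e ∉ E(H)) : ¬ H.Reachable y x := by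
  rintro ⟨p⟩
  obtain ⟨q, hq⟩ := p.exists_isPath
  have hedge : ∀ {u v : α} (q : H.Walk u v), e ∉ q.edges := by
    intro u v q
    induction q with
    | nil hx => exact List.not_mem_nil
    | cons f hl q ih =>
      intro he
      rcases List.mem_cons.1 he with rfl | he
      · exact heH hl.edge_mem
      · exact ih he
  obtain ⟨r, hr1, hr2⟩ := q.exists_walk_of_le hH
  refine hT.2 x (.cons e h r) ⟨List.cons_ne_nil _ _, ?_, ?_⟩
  · rw [Walk.edges, hr2]
    exact List.nodup_cons.2 ⟨hedge q, hq.nodup_edges⟩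
  · rw [Walk.support, hr1]
    exact hq

end Graph

/-! ### Drawings of subgraphs -/

namespace PlaneDrawing

variable {α β : Type*} {G : Graph α β} (D : PlaneDrawing G)

/-- The part of the drawing that consists of the vertices in `W` and the edges in `A`. -/
def sketch (W : Set α) (A : Set β) : Set ℂ := D.pos '' W ∪ ⋃ e ∈ A, D.edgeCurve e

variable {D}

theorem sketch_mono {W W' : Set α} {A A' : Set β} (hW : W ⊆ W') (hA : A ⊆ A') :
    D.sketch W A ⊆ D.sketch W' A' :=
  Set.union_subset_union (Set.image_mono hW) (Set.biUnion_subset_biUnion_left hA)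

theorem edgeCurve_subset_sketch (W : Set α) {A : Set β} {e : β} (he : e ∈ A) :
    D.edgeCurve e ⊆ D.sketch W A :=
  fun _ hz => Or.inr (Set.mem_biUnion he hz)

theorem sketch_insert (W : Set α) (A : Set β) (e : β) :
    D.sketch W (insert e A) = D.sketch W A ∪ D.edgeCurve e := by
  simp only [sketch, Set.biUnion_insert]
  rw [Set.union_assoc, Set.union_comm (D.edgeCurve e)]

theorem sketch_vertexSet_edgeSet : D.sketch V(G) E(G) = D.carrier := rfl

theorem carrier_eq_union {e : β} (he : e ∈ E(G)) :
    D.carrier = D.sketch V(G) (E(G) \ {e}) ∪ D.edgeCurve e := by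
  rw [← sketch_insert, Set.insert_sdiff_singleton, Set.insert_eq_of_mem he,
    sketch_vertexSet_edgeSet]

theorem isCompact_edgeCurve {e : β} (he : e ∈ E(G)) : IsCompact (D.edgeCurve e) :=
  isCompact_Icc.image_of_continuousOn (D.arc_continuousOn e he)

theorem isCompact_sketch {W : Set α} (hW : W.Finite) {A : Set β} (hA : A.Finite) (hAE : A ⊆ E(G)) :
    IsCompact (D.sketch W A) :=
  (hW.image _).isCompact.union (hA.isCompact_biUnion fun _ he => isCompact_edgeCurve (hAE he))

/-- A point of an edge is an interior point of the edge or one of the ends. -/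
theorem mem_edgeCurve {e : β} (he : e ∈ E(G)) {z : ℂ} (hz : z ∈ D.edgeCurve e) :
    (∃ t ∈ Set.Ioo (0 : ℝ) 1, D.arc e t = z) ∨ ∃ x, G.Inc e x ∧ z = D.pos x := by
  obtain ⟨x, y, hxy, h0, h1⟩ := D.arc_ends e he
  obtain ⟨t, ht, rfl⟩ := hz
  rcases eq_or_lt_of_le ht.1 with rfl | ht0
  · exact Or.inr ⟨x, hxy.inc_left, h0⟩
  rcases eq_or_lt_of_le ht.2 with rfl | ht1
  · exact Or.inr ⟨y, hxy.inc_right, h1⟩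
  · exact Or.inl ⟨t, ⟨ht0, ht1⟩, rfl⟩

theorem arc_notMem_sketch {W : Set α} (hW : W ⊆ V(G)) {A : Set β} (hA : A ⊆ E(G)) {e : β}
    (he : e ∈ E(G)) (heA : e ∉ A) {t : ℝ} (ht : t ∈ Set.Ioo (0 : ℝ) 1) :
    D.arc e t ∉ D.sketch W A := by
  rintro (⟨x, hx, h⟩ | h)
  · exact D.arc_ne_pos e he t ht x (hW hx) h.symm
  · obtain ⟨f, hf, hz⟩ := Set.mem_iUnion₂.1 h
    rcases mem_edgeCurve (hA hf) hz with ⟨s, hs, h⟩ | ⟨x, hx, h⟩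
    · exact D.arc_ne_arc f (hA hf) e he (fun h => heA (h ▸ hf)) s hs t ht h
    · exact D.arc_ne_pos e he t ht x hx.vertex_mem h

theorem isAttachedArc {W : Set α} (hW : W ⊆ V(G)) {A : Set β} (hA : A ⊆ E(G)) {e : β}
    (he : e ∈ E(G)) (heA : e ∉ A) (heW : ∀ x, G.Inc e x → x ∈ W) :
    IsAttachedArc (D.sketch W A) (D.arc e) := by
  obtain ⟨x, y, hxy, h0, h1⟩ := D.arc_ends e he
  refine ⟨D.arc_continuousOn e he, D.arc_injOn e he,
    fun t ht => arc_notMem_sketch hW hA he heA ht, ?_, ?_⟩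
  · rw [h0]
    exact Or.inl ⟨x, heW x hxy.inc_left, rfl⟩
  · rw [h1]
    exact Or.inl ⟨y, heW y hxy.inc_right, rfl⟩

/-- Disjoint subgraphs have disjoint drawings. -/
theorem disjoint_sketch {W W' : Set α} {A A' : Set β} (hW : W ⊆ V(G)) (hW' : W' ⊆ V(G))
    (hA : A ⊆ E(G)) (hA' : A' ⊆ E(G)) (hWW : Disjoint W W') (hAA : Disjoint A A')
    (hAW : ∀ e ∈ A, ∀ x, G.Inc e x → x ∈ W) (hAW' : ∀ e ∈ A', ∀ x, G.Inc e x → x ∈ W') :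
    Disjoint (D.sketch W A) (D.sketch W' A') := by
  have key : ∀ {W : Set α} {A : Set β}, A ⊆ E(G) → (∀ e ∈ A, ∀ x, G.Inc e x → x ∈ W) →
      ∀ z ∈ D.sketch W A, (∃ x ∈ W, z = D.pos x) ∨
        ∃ e ∈ A, ∃ t ∈ Set.Ioo (0 : ℝ) 1, D.arc e t = z := by
    rintro W A hA hAW z (⟨x, hx, rfl⟩ | h)
    · exact Or.inl ⟨x, hx, rfl⟩
    · obtain ⟨f, hf, hz⟩ := Set.mem_iUnion₂.1 h
      rcases mem_edgeCurve (hA hf) hz with h | ⟨x, hx, h⟩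
      · exact Or.inr ⟨f, hf, h⟩
      · exact Or.inl ⟨x, hAW f hf x hx, h⟩
  rw [Set.disjoint_left]
  intro z hz hz'
  rcases key hA hAW z hz with ⟨x, hx, rfl⟩ | ⟨e, he, t, ht, rfl⟩
  · rcases hz' with ⟨y, hy, h⟩ | h
    · exact Set.disjoint_left.1 hWW hx (D.pos_injOn (hW' hy) (hW hx) h ▸ hy)
    · rcases key hA' hAW' _ (Or.inr h) with ⟨y, hy, h⟩ | ⟨f, hf, s, hs, h⟩
      · exact Set.disjoint_left.1 hWW hx (D.pos_injOn (hW hx) (hW' hy) h ▸ hy)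
      · exact D.arc_ne_pos f (hA' hf) s hs x (hW hx) h
  · exact arc_notMem_sketch hW' hA' (hA he) (Set.disjoint_left.1 hAA he) ht hz'

/-- The drawing of a connected component is connected. -/
theorem isPreconnected_sketch_component {H : Graph α β} (hH : H ≤ G) {u : α} (hu : u ∈ V(H)) :
    IsPreconnected (D.sketch (H.component u) {e | ∃ x ∈ H.component u, H.Inc e x}) := by
  set S := D.sketch (H.component u) {e | ∃ x ∈ H.component u, H.Inc e x} with hS
  have hpos : ∀ x ∈ H.component u, D.pos x ∈ S := fun x hx => Or.inl ⟨x, hx, rfl⟩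
  have hedge : ∀ e ∈ E(G), IsPreconnected (D.edgeCurve e) := fun e he =>
    isPreconnected_Icc.image _ (D.arc_continuousOn e he)
  have hend : ∀ e x, G.Inc e x → D.pos x ∈ D.edgeCurve e := by
    intro e x hx
    obtain ⟨a, b, hab, h0, h1⟩ := D.arc_ends e hx.edge_mem
    rcases hx.eq_or_eq_of_isLink hab with rfl | rfl
    · exact ⟨0, ⟨le_rfl, zero_le_one⟩, h0⟩
    · exact ⟨1, ⟨zero_le_one, le_rfl⟩, h1⟩
  have hwalk : ∀ {x y : α} (_ : H.Walk x y), x ∈ H.component u →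
      ∃ t ⊆ S, D.pos x ∈ t ∧ D.pos y ∈ t ∧ IsPreconnected t := by
    intro x y p
    induction p with
    | nil hx => exact fun hxu => ⟨_, Set.singleton_subset_iff.2 (hpos _ hxu), rfl, rfl,
        isPreconnected_singleton⟩
    | @cons x y z e h p ih =>
      intro hxu
      obtain ⟨t, htS, hyt, hzt, ht⟩ := ih (Graph.Reachable.trans hxu h.reachable)
      have hG := h.mono hH
      refine ⟨D.edgeCurve e ∪ t, Set.union_subset
        (edgeCurve_subset_sketch _ ⟨x, hxu, h.inc_left⟩) htS,
        Or.inl (hend e x hG.inc_left), Or.inr hzt, ?_⟩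
      exact IsPreconnected.union (D.pos y) (hend e y hG.inc_right) hyt (hedge e hG.edge_mem) ht
  refine isPreconnected_of_forall (D.pos u) ?_
  rintro z (⟨x, hx, rfl⟩ | h)
  · exact hwalk hx.some (Graph.Reachable.refl hu)
  · obtain ⟨e, ⟨x, hx, hex⟩, hz⟩ := Set.mem_iUnion₂.1 h
    obtain ⟨t, htS, hut, hxt, ht⟩ := hwalk hx.some (Graph.Reachable.refl hu)
    have hG := hex.mono hH
    refine ⟨t ∪ D.edgeCurve e, Set.union_subset htS (edgeCurve_subset_sketch _ ⟨x, hx, hex⟩),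
      Or.inl hut, Or.inr hz, ?_⟩
    exact IsPreconnected.union (D.pos x) hxt (hend e x hG) ht (hedge e hG.edge_mem)

/-- Every nonvanishing continuous function has a continuous logarithm on the drawing of a tree, and
more generally on the drawing of a part of its edges. -/
theorem hasLogOn_sketch_of_isTree {T : Graph α β} (hT : T.IsTree) (hTG : T ≤ G)
    (hV : V(T).Finite) {h : ℂ → ℂ} {A : Set β} (hAf : A.Finite) (hAT : A ⊆ E(T))
    (hc : ContinuousOn h (D.sketch V(T) A)) (h0 : ∀ z ∈ D.sketch V(T) A, h z ≠ 0) :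
    HasLogOn h (D.sketch V(T) A) := by
  induction A, hAf using Set.Finite.induction_on with
  | empty =>
    have hfin : (D.sketch V(T) ∅).Finite := by
      simp only [sketch, Set.mem_empty_iff_false, Set.iUnion_of_empty, Set.iUnion_empty,
        Set.union_empty]
      exact hV.image _
    exact ⟨fun z => Complex.log (h z), hfin.continuousOn _,
      fun z hz => Complex.exp_log (h0 z hz)⟩
  | @insert e A heA hAf ih =>
    have hsub : D.sketch V(T) A ⊆ D.sketch V(T) (insert e A) :=
      sketch_mono subset_rfl (Set.subset_insert _ _)
    have hAT' : A ⊆ E(T) := (Set.subset_insert _ _).trans hAT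
    obtain ⟨φ, hφ, hφe⟩ := ih hAT' (hc.mono hsub) fun z hz => h0 z (hsub hz)
    have heT : e ∈ E(T) := hAT (Set.mem_insert _ _)
    have hVG : V(T) ⊆ V(G) := hTG.vertexSet_mono
    have hEG : E(T) ⊆ E(G) := hTG.edgeSet_mono
    have hinc : ∀ {f}, f ∈ E(T) → ∀ x, G.Inc f x → T.Inc f x := fun hf x hx =>
      (hTG.inc_congr hf).2 hx
    have hγ : IsAttachedArc (D.sketch V(T) A) (D.arc e) :=
      isAttachedArc hVG (hAT'.trans hEG) (hEG heT) heA fun x hx => (hinc heT x hx).vertex_mem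
    have hmem : ∀ t ∈ Set.Icc (0 : ℝ) 1, D.arc e t ∈ D.sketch V(T) (insert e A) := fun t ht =>
      edgeCurve_subset_sketch _ (Set.mem_insert _ _) ⟨t, ht, rfl⟩
    obtain ⟨ψ, hψ, hψe⟩ := exists_log_Icc zero_le_one (u := h ∘ D.arc e)
      (hc.comp hγ.continuousOn hmem) fun t ht => h0 _ (hmem t ht)
    obtain ⟨n, hn⟩ := hγ.exists_jump hφe hψe
    obtain ⟨x, y, hxy, hx, hy⟩ := D.arc_ends e (hEG heT)
    have hxyT : T.IsLink e x y := (hTG.isLink_iff heT).2 hxy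
    -- The part of the drawing that is connected with `y` is separated from the part that is
    -- connected with `x`, so that the logarithm can be changed on it by a constant.
    set H := T.restrict A with hH
    have hHT : H ≤ T := Graph.restrict_le
    have hnr : ¬ H.Reachable y x := hT.not_reachable hxyT hHT fun he => heA he.2
    set W := H.component y with hW
    set B : Set β := {f | f ∈ A ∧ ∃ w ∈ W, G.Inc f w} with hB
    have hWT : W ⊆ V(T) := fun w hw => hHT.vertexSet_mono hw.symm.left_mem
    have hBW : ∀ f ∈ B, ∀ w, G.Inc f w → w ∈ W := by
      rintro f ⟨hfA, w, hw, hfw⟩ w' hfw'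
      have h1 := hinc (hAT' hfA) w hfw
      have h2 := hinc (hAT' hfA) w' hfw'
      obtain ⟨v, hv⟩ := h1
      rcases h2.eq_or_eq_of_isLink hv with rfl | rfl
      · exact hw
      · exact hw.trans (Graph.IsLink.reachable (G := H) (e := f) ⟨hfA, hv⟩)
    have hBW' : ∀ f ∈ A \ B, ∀ w, G.Inc f w → w ∈ V(T) \ W := fun f hf w hfw =>
      ⟨(hinc (hAT' hf.1) w hfw).vertex_mem, fun hw => hf.2 ⟨hf.1, w, hw, hfw⟩⟩
    have hBA : B ⊆ A := fun f hf => hf.1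
    set K₁ := D.sketch W B with hK₁
    set K₂ := D.sketch (V(T) \ W) (A \ B) with hK₂
    have hdisj : Disjoint K₁ K₂ := disjoint_sketch (hWT.trans hVG)
      (Set.sdiff_subset.trans hVG) (hBA.trans (hAT'.trans hEG))
      (Set.sdiff_subset.trans (hAT'.trans hEG)) Set.disjoint_sdiff_right Set.disjoint_sdiff_right
      hBW hBW'
    have hK₁c : IsClosed K₁ := (isCompact_sketch (hV.subset hWT) (hAf.subset hBA)
      (hBA.trans (hAT'.trans hEG))).isClosed
    have hK₂c : IsClosed K₂ := (isCompact_sketch (hV.subset Set.sdiff_subset)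
      (hAf.subset Set.sdiff_subset) (Set.sdiff_subset.trans (hAT'.trans hEG))).isClosed
    have hunion : D.sketch V(T) A = K₁ ∪ K₂ := by
      refine Set.Subset.antisymm ?_ (Set.union_subset (sketch_mono hWT hBA)
        (sketch_mono Set.sdiff_subset Set.sdiff_subset))
      rintro z (⟨w, hw, rfl⟩ | hz)
      · by_cases hwW : w ∈ W
        · exact Or.inl (Or.inl ⟨w, hwW, rfl⟩)
        · exact Or.inr (Or.inl ⟨w, ⟨hw, hwW⟩, rfl⟩)
      · obtain ⟨f, hf, hz⟩ := Set.mem_iUnion₂.1 hz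
        by_cases hfB : f ∈ B
        · exact Or.inl (edgeCurve_subset_sketch _ hfB hz)
        · exact Or.inr (edgeCurve_subset_sketch _ (show f ∈ A \ B from ⟨hf, hfB⟩) hz)
    classical
    let φ' : ℂ → ℂ := fun z => if z ∈ K₁ then φ z + n * (2 * Real.pi * Complex.I) else φ z
    have hφ₁ : ∀ z ∈ K₁, φ' z = φ z + n * (2 * Real.pi * Complex.I) := fun z hz => if_pos hz
    have hφ₂ : ∀ z ∈ K₂, φ' z = φ z := fun z hz => if_neg (Set.disjoint_right.1 hdisj hz)
    have hyK : D.arc e 1 ∈ K₁ := by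
      rw [hy]
      exact Or.inl ⟨y, Graph.Reachable.refl (show y ∈ V(H) from hxyT.right_mem), rfl⟩
    have hxK : D.arc e 0 ∈ K₂ := by
      rw [hx]
      exact Or.inl ⟨x, ⟨hxyT.left_mem, hnr⟩, rfl⟩
    rw [sketch_insert]
    refine hγ.hasLogOn_union (isCompact_sketch hV hAf (hAT'.trans hEG)).isClosed (φ := φ')
      ?_ ?_ hψ hψe ?_
    · rw [hunion] at hφ ⊢
      exact ContinuousOn.union_of_isClosed
        (((hφ.mono Set.subset_union_left).add continuousOn_const).congr hφ₁)
        ((hφ.mono Set.subset_union_right).congr hφ₂) hK₁c hK₂c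
    · intro z hz
      have hz' := hz
      rw [hunion] at hz'
      rcases hz' with h | h
      · rw [hφ₁ z h, Complex.exp_add, Complex.exp_int_mul_two_pi_mul_I, mul_one, hφe z hz]
      · rw [hφ₂ z h, hφe z hz]
    · rw [hφ₁ _ hyK, hφ₂ _ hxK]
      linear_combination hn

/-- The drawing of a tree does not separate the plane. -/
theorem isPreconnected_compl_sketch_of_isTree {T : Graph α β} (hT : T.IsTree) (hTG : T ≤ G)
    (hV : V(T).Finite) (hE : E(T).Finite) : IsPreconnected (D.sketch V(T) E(T))ᶜ := by
  have hK : IsCompact (D.sketch V(T) E(T)) := isCompact_sketch hV hE hTG.edgeSet_mono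
  refine isPreconnected_of_forall_pair fun p hp q hq =>
    ⟨connectedComponentIn (D.sketch V(T) E(T))ᶜ p, connectedComponentIn_subset _ _,
      mem_connectedComponentIn hp,
      ?_, isPreconnected_connectedComponentIn⟩
  have hne : ∀ {p}, p ∈ (D.sketch V(T) E(T))ᶜ → ∀ z ∈ D.sketch V(T) E(T), z - p ≠ 0 :=
    fun hp z hz h0 => hp (sub_eq_zero.1 h0 ▸ hz)
  refine mem_connectedComponentIn_of_hasLogOn hK hp hq
    (hasLogOn_sketch_of_isTree hT hTG hV hE subset_rfl
      (ContinuousOn.div (by fun_prop) (by fun_prop) (hne hq))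
      fun z hz => div_ne_zero (hne hp z hz) (hne hq z hz))

end PlaneDrawing

/-! ### Faces and dual edges -/

namespace PlaneDrawing

variable {α β : Type*} {G : Graph α β} {D : PlaneDrawing G}

theorem isCompact_carrier (hV : V(G).Finite) (hE : E(G).Finite) : IsCompact D.carrier :=
  isCompact_sketch hV hE subset_rfl

theorem isFace_connectedComponentIn {z : ℂ} (hz : z ∉ D.carrier) :
    D.IsFace (connectedComponentIn D.carrierᶜ z) :=
  ⟨z, hz, rfl⟩

namespace IsFace

variable {X Y : Set ℂ}

theorem eq_connectedComponentIn (hX : D.IsFace X) {z : ℂ} (hz : z ∈ X) :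
    X = connectedComponentIn D.carrierᶜ z := by
  obtain ⟨w, hw, rfl⟩ := hX
  exact connectedComponentIn_eq hz

theorem eq_of_mem (hX : D.IsFace X) (hY : D.IsFace Y) {z : ℂ} (hzX : z ∈ X) (hzY : z ∈ Y) :
    X = Y :=
  (hX.eq_connectedComponentIn hzX).trans (hY.eq_connectedComponentIn hzY).symm

theorem nonempty (hX : D.IsFace X) : X.Nonempty := by
  obtain ⟨w, hw, rfl⟩ := hX
  exact ⟨w, mem_connectedComponentIn hw⟩

theorem subset_compl (hX : D.IsFace X) : X ⊆ D.carrierᶜ := by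
  obtain ⟨w, hw, rfl⟩ := hX
  exact connectedComponentIn_subset _ _

theorem isPreconnected (hX : D.IsFace X) : IsPreconnected X := by
  obtain ⟨w, hw, rfl⟩ := hX
  exact isPreconnected_connectedComponentIn

theorem isOpen (hX : D.IsFace X) (hV : V(G).Finite) (hE : E(G).Finite) : IsOpen X := by
  obtain ⟨w, hw, rfl⟩ := hX
  exact (isCompact_carrier hV hE).isClosed.isOpen_compl.connectedComponentIn

end IsFace

theorem isFace_outerFace (hV : V(G).Finite) (hE : E(G).Finite) : D.IsFace D.outerFace := by
  have hb := (isCompact_carrier (D := D) hV hE).isBounded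
  obtain ⟨p, hp, hpb⟩ := exists_not_isBounded_connectedComponentIn hb
  refine ⟨p, hp, Set.Subset.antisymm ?_ fun z hz => ⟨connectedComponentIn_subset _ _ hz, ?_⟩⟩
  · rintro z ⟨hz, hzb⟩
    rw [connectedComponentIn_eq_of_not_isBounded hb hpb hzb]
    exact mem_connectedComponentIn hz
  · rwa [← connectedComponentIn_eq hz]

variable (D) in
/-- The component of the complement of the drawing of `G - e` in which the edge `e` is drawn: the
union of the faces that have `e` in their boundary and of the interior of `e`. -/
def side (e : β) : Set ℂ := connectedComponentIn (D.sketch V(G) (E(G) \ {e}))ᶜ (D.arc e (1 / 2))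

theorem isCompact_sketch_sdiff (hV : V(G).Finite) (hE : E(G).Finite) (e : β) :
    IsCompact (D.sketch V(G) (E(G) \ {e})) :=
  isCompact_sketch hV (hE.subset Set.sdiff_subset) Set.sdiff_subset

theorem isAttachedArc_sdiff {e : β} (he : e ∈ E(G)) :
    IsAttachedArc (D.sketch V(G) (E(G) \ {e})) (D.arc e) :=
  isAttachedArc subset_rfl Set.sdiff_subset he (fun h => h.2 rfl) fun _ hx => hx.vertex_mem

theorem isOpen_side (hV : V(G).Finite) (hE : E(G).Finite) (e : β) : IsOpen (D.side e) :=
  (isCompact_sketch_sdiff hV hE e).isClosed.isOpen_compl.connectedComponentIn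

theorem arc_half_mem_side {e : β} (he : e ∈ E(G)) : D.arc e (1 / 2) ∈ D.side e :=
  mem_connectedComponentIn ((isAttachedArc_sdiff he).notMem _ (by norm_num))

theorem arc_image_subset_side {e : β} (he : e ∈ E(G)) : D.arc e '' Set.Ioo 0 1 ⊆ D.side e := by
  refine IsPreconnected.subset_connectedComponentIn
    (isPreconnected_Ioo.image _ ((D.arc_continuousOn e he).mono Set.Ioo_subset_Icc_self))
    ⟨1 / 2, by norm_num, rfl⟩ ?_
  rintro _ ⟨t, ht, rfl⟩
  exact (isAttachedArc_sdiff he).notMem t ht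

theorem side_subset_compl (e : β) : D.side e ⊆ (D.sketch V(G) (E(G) \ {e}))ᶜ :=
  connectedComponentIn_subset _ _

theorem IsFace.subset_side {X : Set ℂ} (hX : D.IsFace X) {e : β} {z : ℂ} (hzX : z ∈ X)
    (hz : z ∈ D.side e) : X ⊆ D.side e := by
  rw [side, connectedComponentIn_eq hz]
  refine hX.isPreconnected.subset_connectedComponentIn hzX (hX.subset_compl.trans ?_)
  exact Set.compl_subset_compl.2 (sketch_mono subset_rfl Set.sdiff_subset)

theorem IsFace.subset_side_of_mem_closure (hV : V(G).Finite) (hE : E(G).Finite) {X : Set ℂ}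
    (hX : D.IsFace X) {e : β} {z : ℂ} (hzX : z ∈ closure X) (hz : z ∈ D.side e) :
    X ⊆ D.side e := by
  obtain ⟨w, hw, hwX⟩ := mem_closure_iff.1 hzX _ (isOpen_side hV hE e) hz
  exact hX.subset_side hwX hw

theorem IsFace.inBoundary_iff (hV : V(G).Finite) (hE : E(G).Finite) {X : Set ℂ} (hX : D.IsFace X)
    {e : β} (he : e ∈ E(G)) : D.InBoundary e X ↔ X ⊆ D.side e := by
  constructor
  · rintro ⟨-, h⟩
    exact hX.subset_side_of_mem_closure hV hE
      (frontier_subset_closure (h ⟨1 / 2, by norm_num, rfl⟩)) (arc_half_mem_side he)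
  · intro h
    obtain ⟨p, hp⟩ := hX.nonempty
    have hpc := hX.subset_compl hp
    refine ⟨he, ?_⟩
    rw [hX.eq_connectedComponentIn hp, carrier_eq_union he]
    exact (isAttachedArc_sdiff he).image_subset_frontier (isCompact_sketch_sdiff hV hE e)
      isPreconnected_connectedComponentIn (side_subset_compl e) (arc_image_subset_side he)
      ⟨h hp, fun hpe => hpc (edgeCurve_subset_sketch _ he hpe)⟩

theorem exists_isFace_inBoundary (hV : V(G).Finite) (hE : E(G).Finite) {e : β} (he : e ∈ E(G)) :
    ∃ X, D.IsFace X ∧ D.InBoundary e X := by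
  obtain ⟨p, hp, hpe⟩ := (isAttachedArc_sdiff he).exists_notMem_image (isOpen_side (D := D) hV hE e)
    (arc_half_mem_side he)
  have hpc : p ∉ D.carrier := by
    rw [carrier_eq_union he]
    rintro (h | h)
    exacts [side_subset_compl e hp h, hpe h]
  have hX := isFace_connectedComponentIn hpc
  exact ⟨_, hX, (hX.inBoundary_iff hV hE he).2
    (hX.subset_side (mem_connectedComponentIn hpc) hp)⟩

/-- Every edge of a plane graph has a dual edge. -/
theorem exists_dual_isLink (hV : V(G).Finite) (hE : E(G).Finite) {e : β} (he : e ∈ E(G)) :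
    ∃ X Y, D.dual.IsLink e X Y := by
  have htwo : ∀ X Y Z, (D.IsFace X ∧ D.InBoundary e X) → (D.IsFace Y ∧ D.InBoundary e Y) →
      (D.IsFace Z ∧ D.InBoundary e Z) → X = Y ∨ X = Z ∨ Y = Z := by
    rintro X Y Z ⟨hX, hXe⟩ ⟨hY, hYe⟩ ⟨hZ, hZe⟩
    obtain ⟨p, hp⟩ := hX.nonempty
    obtain ⟨q, hq⟩ := hY.nonempty
    obtain ⟨r, hr⟩ := hZ.nonempty
    have hmem : ∀ {W p}, D.IsFace W → D.InBoundary e W → p ∈ W →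
        p ∈ D.side e \ D.arc e '' Set.Icc 0 1 := fun hW hWe hp =>
      ⟨(hW.inBoundary_iff hV hE he).1 hWe hp, fun hpe =>
        hW.subset_compl hp (edgeCurve_subset_sketch _ he hpe)⟩
    have h3 := (isAttachedArc_sdiff (D := D) he).two_components (isCompact_sketch_sdiff hV hE e)
      isPreconnected_connectedComponentIn (side_subset_compl e)
      (hmem hX hXe hp) (hmem hY hYe hq) (hmem hZ hZe hr)
    have hcar : D.sketch V(G) (E(G) \ {e}) ∪ D.arc e '' Set.Icc 0 1 = D.carrier :=
      (carrier_eq_union he).symm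
    rw [hcar, ← hX.eq_connectedComponentIn hp, ← hY.eq_connectedComponentIn hq] at h3
    rcases h3 with h | h | h
    · exact Or.inl (hX.eq_of_mem hY h hq)
    · exact Or.inr (Or.inl (hX.eq_of_mem hZ h hr))
    · exact Or.inr (Or.inr (hY.eq_of_mem hZ h hr))
  obtain ⟨X, hX⟩ := exists_isFace_inBoundary (D := D) hV hE he
  by_cases hY : ∃ Y, (D.IsFace Y ∧ D.InBoundary e Y) ∧ X ≠ Y
  · obtain ⟨Y, hY, hXY⟩ := hY
    refine ⟨X, Y, he, Set.Subset.antisymm (fun Z hZ => ?_) ?_⟩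
    · rcases htwo X Y Z hX hY hZ with h | h | h
      exacts [absurd h hXY, Or.inl h.symm, Or.inr h.symm]
    · rintro Z (rfl | rfl)
      exacts [hX, hY]
  · push Not at hY
    refine ⟨X, X, he, Set.Subset.antisymm (fun Z hZ => Or.inl (hY Z hZ).symm) ?_⟩
    rintro Z (rfl | rfl)
    exacts [hX, hX]

theorem dual_isLink_left {e : β} {X Y : Set ℂ} (h : D.dual.IsLink e X Y) :
    D.IsFace X ∧ D.InBoundary e X := by
  have : X ∈ {X | D.IsFace X ∧ D.InBoundary e X} := h.2 ▸ Set.mem_insert X {Y}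
  exact this

/-- Two faces with a common edge `e` in their boundaries are joined by the dual edge of `e`. -/
theorem reachable_of_inBoundary (hV : V(G).Finite) (hE : E(G).Finite) {S : Set β} {e : β}
    (he : e ∈ E(G)) (heS : e ∈ S) {X Y : Set ℂ} (hX : D.IsFace X ∧ D.InBoundary e X)
    (hY : D.IsFace Y ∧ D.InBoundary e Y) : (D.dual.restrict S).Reachable X Y := by
  obtain ⟨F, H, hFH⟩ := exists_dual_isLink (D := D) hV hE he
  have hFH' : (D.dual.restrict S).IsLink e F H := ⟨heS, hFH⟩
  have hmem : ∀ {Z}, D.IsFace Z ∧ D.InBoundary e Z → Z = F ∨ Z = H := fun {Z} hZ => by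
    have : Z ∈ {X | D.IsFace X ∧ D.InBoundary e X} := hZ
    rwa [hFH.2] at this
  rcases hmem hX with rfl | rfl <;> rcases hmem hY with rfl | rfl
  · exact .refl hX.1
  · exact hFH'.reachable
  · exact hFH'.symm.reachable
  · exact .refl hX.1

/-- For a spanning tree `T` of `G`, the dual edges of the edges outside `T` connect all faces: the
drawing of `T` does not separate the plane, and a path in its complement crosses edges
outside `T` only. -/
theorem reachable_dual_restrict (hV : V(G).Finite) (hE : E(G).Finite) {T : Graph α β}
    (hT : G.IsSpanningTree T) {X Y : Set ℂ} (hX : D.IsFace X) (hY : D.IsFace Y) :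
    (D.dual.restrict (E(G) \ E(T))).Reachable X Y := by
  obtain ⟨hTG, hTT⟩ := hT
  have hVT : V(T) = V(G) := hTG.vertexSet_eq
  have hS := isPreconnected_compl_sketch_of_isTree (D := D) hTT hTG.le
    (by rw [hVT]; exact hV) (hE.subset hTG.le.edgeSet_mono)
  set S := (D.sketch V(T) E(T))ᶜ with hSdef
  have hcar : D.carrierᶜ ⊆ S :=
    Set.compl_subset_compl.2 (sketch_mono hTG.le.vertexSet_mono hTG.le.edgeSet_mono)
  have hcases : ∀ z ∈ S, z ∉ D.carrier ∨
      ∃ e ∈ E(G) \ E(T), z ∈ D.arc e '' Set.Ioo 0 1 := by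
    intro z hz
    by_contra! hcon
    obtain ⟨⟨x, hx, rfl⟩ | h, hcon⟩ := hcon
    · exact hz (Or.inl ⟨x, hVT ▸ hx, rfl⟩)
    · obtain ⟨e, he, hze⟩ := Set.mem_iUnion₂.1 h
      by_cases heT : e ∈ E(T)
      · exact hz (edgeCurve_subset_sketch _ heT hze)
      · rcases mem_edgeCurve he hze with h | ⟨x, hx, rfl⟩
        · exact hcon e ⟨he, heT⟩ h
        · exact hz (Or.inl ⟨x, hVT ▸ hx.vertex_mem, rfl⟩)
  have hex : ∀ z ∈ S, ∃ X, D.IsFace X ∧ z ∈ closure X := by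
    intro z hz
    rcases hcases z hz with h | ⟨e, he, t, ht, rfl⟩
    · exact ⟨_, isFace_connectedComponentIn h, subset_closure (mem_connectedComponentIn h)⟩
    · obtain ⟨X, hX, hXe⟩ := exists_isFace_inBoundary (D := D) hV hE he.1
      exact ⟨X, hX, frontier_subset_closure (hXe.2 ⟨t, Set.Ioo_subset_Icc_self ht, rfl⟩)⟩
  obtain ⟨p, hp⟩ := hX.nonempty
  obtain ⟨q, hq⟩ := hY.nonempty
  refine hS.induction₂ (fun z w => ∀ X Y, D.IsFace X → D.IsFace Y → z ∈ closure X →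
    w ∈ closure Y → (D.dual.restrict (E(G) \ E(T))).Reachable X Y) ?_ ?_ ?_
    (hcar (hX.subset_compl hp)) (hcar (hY.subset_compl hq)) X Y hX hY
    (subset_closure hp) (subset_closure hq)
  · intro z hz
    refine mem_nhdsWithin_of_mem_nhds ?_
    rcases hcases z hz with h | ⟨e, he, hze⟩
    · have hZ := isFace_connectedComponentIn h
      have hopen := hZ.isOpen hV hE
      have hzZ := mem_connectedComponentIn (F := D.carrierᶜ) h
      filter_upwards [hopen.mem_nhds hzZ] with w hw X Y hX hY hzX hwY
      have heq : ∀ {X w}, D.IsFace X → w ∈ closure X →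
          w ∈ connectedComponentIn D.carrierᶜ z → X = connectedComponentIn D.carrierᶜ z := by
        intro X w hX hwX hw
        obtain ⟨v, hv, hvX⟩ := mem_closure_iff.1 hwX _ hopen hw
        exact hX.eq_of_mem hZ hvX hv
      rw [heq hX hzX hzZ, heq hY hwY hw]
      exact .refl hZ
    · have hze' := arc_image_subset_side he.1 hze
      filter_upwards [(isOpen_side hV hE e).mem_nhds hze'] with w hw X Y hX hY hzX hwY
      exact reachable_of_inBoundary hV hE he.1 he
        ⟨hX, (hX.inBoundary_iff hV hE he.1).2 (hX.subset_side_of_mem_closure hV hE hzX hze')⟩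
        ⟨hY, (hY.inBoundary_iff hV hE he.1).2 (hY.subset_side_of_mem_closure hV hE hwY hw)⟩
  · intro x y z _ hy _ hxy hyz X Z hX hZ hxX hzZ
    obtain ⟨Y, hY, hyY⟩ := hex y hy
    exact (hxy X Y hX hY hxX hyY).trans (hyz Y Z hY hZ hyY hzZ)
  · intro x y _ _ hxy X Y hX hY hyX hxY
    exact (hxy Y X hY hX hxY hyX).symm

/-- A walk in the dual graph stays within a component of the complement of the edges that it does
not cross. -/
theorem connectedComponentIn_eq_of_reachable (hV : V(G).Finite) (hE : E(G).Finite) {S A : Set β}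
    (hSA : Disjoint S A) {W : Set α} (hW : W ⊆ V(G)) (hA : A ⊆ E(G)) {X Y : Set ℂ}
    (h : (D.dual.restrict S).Reachable X Y) {p q : ℂ} (hp : p ∈ X) (hq : q ∈ Y) :
    connectedComponentIn (D.sketch W A)ᶜ p = connectedComponentIn (D.sketch W A)ᶜ q := by
  have hcar : ∀ {Z}, D.IsFace Z → Z ⊆ (D.sketch W A)ᶜ := fun hZ =>
    hZ.subset_compl.trans (Set.compl_subset_compl.2 (sketch_mono hW hA))
  obtain ⟨w⟩ := h
  induction w generalizing p with
  | nil hx =>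
    have hX : D.IsFace _ := hx
    exact connectedComponentIn_eq
      (hX.isPreconnected.subset_connectedComponentIn hp (hcar hX) hq)
  | @cons X Y Z e hl w ih =>
    have hX := dual_isLink_left hl.2
    have hY := dual_isLink_left hl.2.symm
    have he : e ∈ E(G) := hX.2.1
    obtain ⟨r, hr⟩ := hY.1.nonempty
    rw [← ih hr hq]
    have hsub : D.side e ⊆ (D.sketch W A)ᶜ := (side_subset_compl e).trans
      (Set.compl_subset_compl.2 (sketch_mono hW fun f hf => ⟨hA hf, fun hfe =>
        Set.disjoint_left.1 hSA hl.1 (Set.mem_singleton_iff.1 hfe ▸ hf)⟩))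
    have hpe := (hX.1.inBoundary_iff hV hE he).1 hX.2 hp
    have hre := (hY.1.inBoundary_iff hV hE he).1 hY.2 hr
    exact connectedComponentIn_eq
      (isPreconnected_connectedComponentIn.subset_connectedComponentIn hpe hsub hre)

/-- Suppose that the ends of the edge `e` are joined in `G - e` by a connected subgraph with edge
set `A`, so that `e` lies on a cycle with edges in `A` and `e`.  Then a walk in the dual graph that
crosses no edge of `A` and does not use `e` cannot join different faces on the two sides of `e`. -/
theorem eq_of_reachable_of_isLink (hV : V(G).Finite) (hE : E(G).Finite) {e : β} {X Y : Set ℂ}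
    (hXY : D.dual.IsLink e X Y) {W : Set α} {A S : Set β} (hW : W ⊆ V(G)) (hA : A ⊆ E(G))
    (heA : e ∉ A) (heS : e ∉ S) (hSA : Disjoint S A) (hconn : IsPreconnected (D.sketch W A))
    (heW : ∀ x, G.Inc e x → x ∈ W) (h : (D.dual.restrict S).Reachable X Y) : X = Y := by
  have hX := dual_isLink_left hXY
  have hY := dual_isLink_left hXY.symm
  have he : e ∈ E(G) := hX.2.1
  obtain ⟨p, hp⟩ := hX.1.nonempty
  obtain ⟨q, hq⟩ := hY.1.nonempty
  have hpc := hX.1.subset_compl hp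
  have hqc := hY.1.subset_compl hq
  have hγ := isAttachedArc (D := D) hW hA he heA heW
  have hAe : A ⊆ E(G) \ {e} := fun f hf => ⟨hA hf, fun hfe =>
    heA (Set.mem_singleton_iff.1 hfe ▸ hf)⟩
  have hins : insert e A ⊆ E(G) := Set.insert_subset he hA
  have hlogK : HasLogOn (fun z => (z - p) / (z - q)) (D.sketch V(G) (E(G) \ {e})) :=
    hasLogOn_div_of_isPreconnected (isCompact_sketch_sdiff hV hE e).isClosed
      isPreconnected_connectedComponentIn (side_subset_compl e)
      ((hX.1.inBoundary_iff hV hE he).1 hX.2 hp) ((hY.1.inBoundary_iff hV hE he).1 hY.2 hq)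
  have hlogL : HasLogOn (fun z => (z - p) / (z - q)) (D.sketch W A ∪ D.arc e '' Set.Icc 0 1) := by
    have hcomp := connectedComponentIn_eq_of_reachable hV hE
      (A := insert e A) (Set.disjoint_insert_right.2 ⟨heS, hSA⟩) hW hins h hp hq
    have hsk : D.sketch W (insert e A) = D.sketch W A ∪ D.arc e '' Set.Icc 0 1 :=
      sketch_insert W A e
    have hout : ∀ {z}, z ∈ D.carrierᶜ → z ∈ (D.sketch W (insert e A))ᶜ := fun hz h =>
      hz (sketch_mono hW hins h)
    rw [← hsk]
    refine hasLogOn_div_of_isPreconnected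
      (isCompact_sketch (hV.subset hW) (hE.subset hins) hins).isClosed
      isPreconnected_connectedComponentIn (connectedComponentIn_subset _ p)
      (mem_connectedComponentIn (hout hpc)) ?_
    rw [hcomp]
    exact mem_connectedComponentIn (hout hqc)
  have hlog := (isAttachedArc_sdiff he).hasLogOn_union_of_isPreconnected
    (isCompact_sketch_sdiff hV hE e).isClosed (sketch_mono hW hAe) hconn hγ.zero_mem hγ.one_mem
    hlogK hlogL
  have hcar : D.sketch V(G) (E(G) \ {e}) ∪ D.arc e '' Set.Icc 0 1 = D.carrier :=
    (carrier_eq_union he).symm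
  rw [hcar] at hlog
  have := mem_connectedComponentIn_of_hasLogOn (isCompact_carrier hV hE) hpc hqc hlog
  rw [← hX.1.eq_connectedComponentIn hp] at this
  exact hX.1.eq_of_mem hY.1 this hq

end PlaneDrawing

/-! ### Search trees -/

namespace Graph

variable {α β : Type*} {Q Q' T G : Graph α β} {O : α}

/-- A spanning tree of `Q` rooted at `O`, given by the parent of every vertex `x ≠ O`, the edge
between `x` and its parent, and the depth of `x`.  The values of `par` and `edge` at `O` and outside
the vertex set are irrelevant. -/
structure SearchTree (Q : Graph α β) (O : α) where
  /-- The parent of a vertex. -/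
  par : α → α
  /-- The edge that joins a vertex to its parent. -/
  edge : α → β
  /-- The distance of a vertex from the root. -/
  depth : α → ℕ
  depth_root : depth O = 0
  isLink : ∀ x ∈ V(Q), x ≠ O → Q.IsLink (edge x) x (par x)
  depth_eq : ∀ x ∈ V(Q), x ≠ O → depth x = depth (par x) + 1

/-- The distances from `O` define a breadth-first search tree. -/
theorem nonempty_searchTree [Nonempty β] (hO : O ∈ V(Q)) (h : ∀ x ∈ V(Q), Q.Reachable x O) :
    Nonempty (Q.SearchTree O) := by
  classical
  let d : α → ℕ := fun x => sInf {n | ∃ p : Q.Walk x O, p.length = n}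
  have hd : ∀ {x} (p : Q.Walk x O), d x ≤ p.length := fun p => Nat.sInf_le ⟨p, rfl⟩
  have hex : ∀ x ∈ V(Q), x ≠ O → ∃ y e, Q.IsLink e x y ∧ d x = d y + 1 := by
    intro x hx hxO
    obtain ⟨p, hp⟩ : d x ∈ {n | ∃ p : Q.Walk x O, p.length = n} :=
      Nat.sInf_mem ⟨_, (h x hx).some, rfl⟩
    cases p with
    | nil _ => exact absurd rfl hxO
    | @cons _ y _ e hl p =>
      refine ⟨y, e, hl, ?_⟩
      obtain ⟨q, hq⟩ : d y ∈ {n | ∃ p : Q.Walk y O, p.length = n} :=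
        Nat.sInf_mem ⟨_, p, rfl⟩
      have h1 := hd p
      have h2 := hd (Walk.cons e hl q)
      simp only [Walk.length, Walk.edges, List.length_cons] at h1 h2 hp hq
      omega
  choose! par edge hlink hdepth using hex
  exact ⟨⟨par, edge, d, Nat.le_zero.1 (hd (.nil hO)), hlink, hdepth⟩⟩

namespace SearchTree

variable (τ : Q.SearchTree O) {x y : α}

theorem depth_eq_zero_iff (hx : x ∈ V(Q)) : τ.depth x = 0 ↔ x = O := by
  constructor
  · intro h
    by_contra hne
    have := τ.depth_eq x hx hne
    omega
  · rintro rfl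
    exact τ.depth_root

theorem iterate_par (hx : x ∈ V(Q)) {k : ℕ} (hk : k ≤ τ.depth x) :
    τ.par^[k] x ∈ V(Q) ∧ τ.depth (τ.par^[k] x) + k = τ.depth x := by
  induction k with
  | zero => exact ⟨hx, rfl⟩
  | succ k ih =>
    obtain ⟨h1, h2⟩ := ih (by omega)
    have hne : τ.par^[k] x ≠ O := fun h => by
      have := (τ.depth_eq_zero_iff h1).2 h
      omega
    rw [Function.iterate_succ_apply']
    have := τ.depth_eq _ h1 hne
    exact ⟨(τ.isLink _ h1 hne).right_mem, by omega⟩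

theorem iterate_par_ne (hx : x ∈ V(Q)) {k : ℕ} (hk : k < τ.depth x) : τ.par^[k] x ≠ O := fun h => by
  obtain ⟨h1, h2⟩ := τ.iterate_par hx hk.le
  have := (τ.depth_eq_zero_iff h1).2 h
  omega

theorem iterate_par_depth (hx : x ∈ V(Q)) : τ.par^[τ.depth x] x = O := by
  obtain ⟨h1, h2⟩ := τ.iterate_par hx le_rfl
  exact (τ.depth_eq_zero_iff h1).1 (by omega)

theorem isLink_iterate (hx : x ∈ V(Q)) {k : ℕ} (hk : k < τ.depth x) :
    Q.IsLink (τ.edge (τ.par^[k] x)) (τ.par^[k] x) (τ.par^[k + 1] x) := by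
  rw [Function.iterate_succ_apply']
  exact τ.isLink _ (τ.iterate_par hx hk.le).1 (τ.iterate_par_ne hx hk)

theorem edge_injective (hx : x ∈ V(Q)) (hy : y ∈ V(Q)) (hxO : x ≠ O) (hyO : y ≠ O)
    (h : τ.edge x = τ.edge y) : x = y := by
  have h1 := τ.isLink x hx hxO
  have h2 := τ.isLink y hy hyO
  rw [h] at h1
  rcases h1.eq_and_eq_or_eq_and_eq h2 with ⟨h, -⟩ | ⟨h3, h4⟩
  · exact h
  · have h5 := τ.depth_eq x hx hxO
    have h6 := τ.depth_eq y hy hyO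
    rw [h4] at h5
    rw [← h3] at h6
    omega

/-- The edges on the path from `x` to the root. -/
def pathEdges (x : α) : Set β := {e | ∃ k < τ.depth x, e = τ.edge (τ.par^[k] x)}

theorem pathEdges_root : τ.pathEdges O = ∅ := by
  rw [Set.eq_empty_iff_forall_notMem]
  rintro e ⟨k, hk, -⟩
  rw [τ.depth_root] at hk
  exact absurd hk (Nat.not_lt_zero k)

theorem pathEdges_subset (hx : x ∈ V(Q)) : τ.pathEdges x ⊆ E(Q) := by
  rintro e ⟨k, hk, rfl⟩
  exact (τ.isLink_iterate hx hk).edge_mem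

theorem edge_iterate_injective (hx : x ∈ V(Q)) {i j : ℕ} (hi : i < τ.depth x) (hj : j < τ.depth x)
    (h : τ.edge (τ.par^[i] x) = τ.edge (τ.par^[j] x)) : i = j := by
  obtain ⟨h1, h2⟩ := τ.iterate_par hx hi.le
  obtain ⟨h3, h4⟩ := τ.iterate_par hx hj.le
  have := τ.edge_injective h1 h3 (τ.iterate_par_ne hx hi) (τ.iterate_par_ne hx hj) h
  rw [this] at h2
  omega

theorem encard_pathEdges (hx : x ∈ V(Q)) : (τ.pathEdges x).encard = τ.depth x := by
  have : τ.pathEdges x = (fun k => τ.edge (τ.par^[k] x)) '' (Finset.range (τ.depth x) : Set ℕ) := by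
    ext e
    constructor
    · rintro ⟨k, hk, rfl⟩
      exact ⟨k, by simpa using hk, rfl⟩
    · rintro ⟨k, hk, rfl⟩
      exact ⟨k, by simpa using hk, rfl⟩
  rw [this, Set.InjOn.encard_image, Set.encard_coe_eq_coe_finsetCard, Finset.card_range]
  intro i hi j hj h
  exact τ.edge_iterate_injective hx (by simpa using hi) (by simpa using hj) h

/-- The last edge on the path from `x` to the root: it names the branch at the root that contains
`x`.  (Irrelevant for the root.) -/
def label (x : α) : β := τ.edge (τ.par^[τ.depth x - 1] x)

theorem label_iterate (hx : x ∈ V(Q)) {k : ℕ} (hk : k < τ.depth x) :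
    τ.label (τ.par^[k] x) = τ.label x := by
  obtain ⟨-, h2⟩ := τ.iterate_par hx hk.le
  rw [label, label, ← Function.iterate_add_apply]
  congr 2
  omega

theorem label_par (hx : x ∈ V(Q)) (hxO : x ≠ O) (hp : τ.par x ≠ O) :
    τ.label (τ.par x) = τ.label x := by
  have h1 := τ.depth_eq x hx hxO
  have h2 := (τ.depth_eq_zero_iff (τ.isLink x hx hxO).right_mem).not.2 hp
  exact τ.label_iterate hx (k := 1) (by omega)

theorem exists_isLink_label (hx : x ∈ V(Q)) (hxO : x ≠ O) :
    ∃ y, y ≠ O ∧ Q.IsLink (τ.label x) y O := by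
  have h0 := (τ.depth_eq_zero_iff hx).not.2 hxO
  have h1 := τ.isLink_iterate hx (k := τ.depth x - 1) (by omega)
  rw [Nat.sub_add_cancel (by omega), τ.iterate_par_depth hx] at h1
  exact ⟨_, τ.iterate_par_ne hx (by omega), h1⟩

theorem disjoint_pathEdges (hx : x ∈ V(Q)) (hy : y ∈ V(Q)) (h : τ.label x ≠ τ.label y) :
    Disjoint (τ.pathEdges x) (τ.pathEdges y) := by
  rw [Set.disjoint_left]
  rintro _ ⟨i, hi, rfl⟩ ⟨j, hj, hij⟩
  have := τ.edge_injective (τ.iterate_par hx hi.le).1 (τ.iterate_par hy hj.le).1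
    (τ.iterate_par_ne hx hi) (τ.iterate_par_ne hy hj) hij
  rw [← τ.label_iterate hx hi, ← τ.label_iterate hy hj, this] at h
  exact h rfl

/-- If the path from `x` to the root contains an edge between `x` and `y`, then this is the first
edge of the path. -/
theorem eq_par_of_mem_pathEdges (hx : x ∈ V(Q)) {g : β} (hg : g ∈ τ.pathEdges x)
    (hl : Q.IsLink g x y) : x ≠ O ∧ g = τ.edge x ∧ y = τ.par x := by
  obtain ⟨i, hi, rfl⟩ := hg
  have h1 := τ.isLink_iterate hx hi
  have hi0 : i = 0 := by
    obtain ⟨-, h2⟩ := τ.iterate_par hx hi.le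
    obtain ⟨-, h3⟩ := τ.iterate_par hx (k := i + 1) hi
    rcases hl.left_eq_or_eq h1 with h | h
    · rw [← h] at h2
      omega
    · rw [← h] at h3
      omega
  subst hi0
  exact ⟨τ.iterate_par_ne hx hi, rfl, hl.right_unique h1⟩

theorem notMem_pathEdges (hx : x ∈ V(Q)) {g : β} (hl : Q.IsLink g x y) (hyO : y ≠ O)
    (h : τ.label x ≠ τ.label y) : g ∉ τ.pathEdges x := by
  intro hg
  obtain ⟨hxO, -, rfl⟩ := τ.eq_par_of_mem_pathEdges hx hg hl
  exact h (τ.label_par hx hxO hyO).symm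

theorem reachable_iterate (hQ : Q ≤ Q') (hx : x ∈ V(Q)) {S : Set β} {k : ℕ}
    (hk : k ≤ τ.depth x) (hS : ∀ j < k, τ.edge (τ.par^[j] x) ∈ S) :
    (Q'.restrict S).Reachable x (τ.par^[k] x) := by
  induction k with
  | zero => exact .refl (hQ.vertexSet_mono hx)
  | succ k ih =>
    refine (ih (by omega) fun j hj => hS j (by omega)).trans ?_
    exact IsLink.reachable (G := Q'.restrict S) (e := τ.edge (τ.par^[k] x))
      ⟨hS k (by omega), (τ.isLink_iterate hx hk).mono hQ⟩

theorem reachable_root (hQ : Q ≤ Q') (hx : x ∈ V(Q)) {S : Set β} (hS : τ.pathEdges x ⊆ S) :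
    (Q'.restrict S).Reachable x O := by
  have := τ.reachable_iterate hQ hx le_rfl fun j hj => hS ⟨j, hj, rfl⟩
  rwa [τ.iterate_par_depth hx] at this

/-- The paths from `x` and `y` to the root and an edge `g` between `x` and `y` form a closed walk:
if one of its edges is omitted, the ends of that edge are still joined by the remaining edges. -/
theorem reachable_of_isLink (hQ : Q ≤ Q') (hx : x ∈ V(Q)) (hy : y ∈ V(Q)) {g : β}
    (hg : Q'.IsLink g x y) {i : ℕ} (hi : i < τ.depth x) {S : Set β}
    (hxS : ∀ e ∈ τ.pathEdges x, e ≠ τ.edge (τ.par^[i] x) → e ∈ S) (hyS : τ.pathEdges y ⊆ S)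
    (hgS : g ∈ S) : (Q'.restrict S).Reachable (τ.par^[i] x) (τ.par^[i + 1] x) := by
  have h1 : (Q'.restrict S).Reachable x (τ.par^[i] x) :=
    τ.reachable_iterate hQ hx hi.le fun j hj => hxS _ ⟨j, by omega, rfl⟩ fun h =>
      hj.ne (τ.edge_iterate_injective hx (by omega) hi h)
  have h2 : (Q'.restrict S).Reachable x y :=
    IsLink.reachable (G := Q'.restrict S) (e := g) ⟨hgS, hg⟩
  have h3 := τ.reachable_root hQ hy hyS
  obtain ⟨h4, h5⟩ := τ.iterate_par hx (k := i + 1) hi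
  have h6 : (Q'.restrict S).Reachable (τ.par^[i + 1] x) O := by
    refine τ.reachable_root hQ h4 ?_
    rintro _ ⟨j, hj, rfl⟩
    rw [← Function.iterate_add_apply]
    refine hxS _ ⟨j + (i + 1), by omega, rfl⟩ fun h => ?_
    have := τ.edge_iterate_injective hx (by omega) hi h
    omega
  exact h1.symm.trans (h2.trans (h3.trans h6.symm))

end SearchTree

/-- Extend a walk by one edge at its end. -/
def Walk.concat {x y z : α} (p : Q.Walk x y) {e : β} (h : Q.IsLink e y z) : Q.Walk x z :=
  match p with
  | .nil _ => .cons e h (.nil h.right_mem)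
  | .cons f h' p => .cons f h' (p.concat h)

theorem Walk.support_concat {x y z : α} (p : Q.Walk x y) {e : β} (h : Q.IsLink e y z) :
    (p.concat h).support = p.support ++ [z] := by
  induction p with
  | nil hx => rfl
  | cons f h' p ih => rw [concat, support, support, ih, List.cons_append]

theorem Walk.edges_concat {x y z : α} (p : Q.Walk x y) {e : β} (h : Q.IsLink e y z) :
    (p.concat h).edges = p.edges ++ [e] := by
  induction p with
  | nil hx => rfl
  | cons f h' p ih => rw [concat, edges, edges, ih, List.cons_append]

namespace SearchTree

variable (τ : Q.SearchTree O) {x y : α}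

theorem exists_isPath (hx : x ∈ V(Q)) : ∃ p : Q.Walk O x, p.IsPath ∧ p.length = τ.depth x ∧
    (∀ y ∈ p.support, τ.depth y ≤ τ.depth x) ∧ (x ≠ O → p.edges.head? = some (τ.label x)) := by
  induction hn : τ.depth x generalizing x with
  | zero =>
    obtain rfl := (τ.depth_eq_zero_iff hx).1 hn
    refine ⟨.nil hx, List.nodup_singleton _, rfl, fun y hy => ?_, fun h => absurd rfl h⟩
    rw [List.mem_singleton.1 hy, hn]
  | succ n ih =>
    have hxO : x ≠ O := fun h => by
      rw [(τ.depth_eq_zero_iff hx).2 h] at hn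
      omega
    have hl := τ.isLink x hx hxO
    have hd := τ.depth_eq x hx hxO
    obtain ⟨p, hp, hlen, hdep, hhead⟩ := ih hl.right_mem (by omega)
    refine ⟨p.concat hl.symm, ?_, ?_, fun y hy => ?_, fun _ => ?_⟩
    · rw [Walk.IsPath, Walk.support_concat, List.nodup_append]
      refine ⟨hp, List.nodup_singleton _, fun a ha b hb hab => ?_⟩
      rw [List.mem_singleton.1 hb] at hab
      have := hdep a ha
      rw [hab] at this
      omega
    · rw [Walk.length, Walk.edges_concat, List.length_append, ← Walk.length, hlen]
      rfl
    · rw [Walk.support_concat, List.mem_append] at hy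
      rcases hy with hy | hy
      · exact (hdep y hy).trans (Nat.le_succ n)
      · rw [List.mem_singleton.1 hy, hn]
    · rw [Walk.edges_concat, List.head?_append]
      by_cases hpO : τ.par x = O
      · have h0 : n = 0 := by
          rw [hpO, τ.depth_root] at hd
          omega
        have : p.edges = [] := List.eq_nil_of_length_eq_zero (hlen.trans h0)
        rw [this, label, hn, h0]
        rfl
      · rw [hhead hpO, τ.label_par hx hxO hpO]
        rfl

end SearchTree

/-! ### Spanning trees and their congestion -/

theorem Walk.reachable_deleteEdges {x y : α} (p : T.Walk x y) {g : β} (hg : g ∉ p.edges) :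
    (T.deleteEdges {g}).Reachable x y := by
  induction p with
  | nil hx => exact .refl hx
  | cons e h p ih =>
    rw [Walk.edges, List.mem_cons, not_or] at hg
    obtain ⟨h1, h2⟩ := hg
    refine Reachable.trans (IsLink.reachable (e := e) ?_) (ih h2)
    rw [deleteEdges_isLink]
    exact ⟨h, fun h' => h1 (Set.mem_singleton_iff.1 h').symm⟩

/-- Every vertex of a connected graph lies in one of the components that arise by deleting
an edge. -/
theorem Reachable.deleteEdges_or {x u v : α} {g : β} (hg : T.IsLink g u v)
    (h : T.Reachable x u) :
    (T.deleteEdges {g}).Reachable u x ∨ (T.deleteEdges {g}).Reachable v x := by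
  obtain ⟨p⟩ := h
  induction p with
  | nil hx => exact Or.inl (.refl hx)
  | @cons x y z e h p ih =>
    by_cases heg : e = g
    · subst heg
      rcases h.left_eq_or_eq hg with rfl | rfl
      · exact Or.inl (.refl hg.left_mem)
      · exact Or.inr (.refl hg.right_mem)
    · have hl : (T.deleteEdges {g}).IsLink e y x := by
        rw [deleteEdges_isLink]
        exact ⟨h.symm, heg⟩
      exact (ih hg).imp (fun h => h.trans hl.reachable) fun h => h.trans hl.reachable

theorem mem_detourEdges_self (hTG : T ≤ G) {g : β} (hg : g ∈ E(T)) : g ∈ G.detourEdges T g := by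
  obtain ⟨u, v, hl⟩ := exists_isLink_of_mem_edgeSet hg
  exact ⟨u, v, hl, u, Reachable.refl (G := T.deleteEdges {g}) hl.left_mem, v,
    Reachable.refl (G := T.deleteEdges {g}) hl.right_mem, hl.mono hTG⟩

theorem encard_detourEdges_le {g : β} (hg : g ∈ E(T)) :
    (G.detourEdges T g).encard ≤ G.edgeCongestion T :=
  le_iSup₂ (f := fun g _ => (G.detourEdges T g).encard) g hg

/-- If `G` has an edge outside the spanning tree `T` that is not a loop, then the congestion of `T`
is at least two: this edge and an edge of the path in `T` between its ends are counted. -/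
theorem two_le_edgeCongestion (hT : G.IsSpanningTree T) {e : β} {x y : α} (he : G.IsLink e x y)
    (hxy : x ≠ y) (heT : e ∉ E(T)) : 2 ≤ G.edgeCongestion T := by
  have hV : V(T) = V(G) := hT.1.vertexSet_eq
  obtain ⟨p, hp⟩ := (hT.2.1.2 x (hV ▸ he.left_mem) y (hV ▸ he.right_mem)).some.exists_isPath
  cases p with
  | nil _ => exact absurd rfl hxy
  | @cons _ z _ g h p =>
    have hx := (List.nodup_cons.1 hp).1
    have hg : g ∉ p.edges := fun hg => hx (p.mem_support_of_mem_edges hg h)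
    have hmem : e ∈ G.detourEdges T g :=
      ⟨x, z, h, x, Reachable.refl (G := T.deleteEdges {g}) h.left_mem, y,
        p.reachable_deleteEdges hg, he⟩
    have hge : g ≠ e := fun h' => heT (h' ▸ h.edge_mem)
    rw [← Set.encard_pair hge]
    refine (Set.encard_le_encard ?_).trans (encard_detourEdges_le h.edge_mem)
    rintro f (rfl | rfl)
    exacts [mem_detourEdges_self hT.1.le h.edge_mem, hmem]

end Graph

/-! ### The congestion of a spanning tree of a plane graph -/

namespace PlaneDrawing

variable {α β : Type*} {G T : Graph α β} {D : PlaneDrawing G}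

theorem component_edges_subset {H : Graph α β} (u : α) :
    {e | ∃ x ∈ H.component u, H.Inc e x} ⊆ E(H) := by
  rintro e ⟨x, -, hx⟩
  exact hx.edge_mem

theorem component_subset {H : Graph α β} (u : α) : H.component u ⊆ V(H) := fun _ hx =>
  Graph.Reachable.left_mem (Graph.Reachable.symm hx)

/-- A dual edge between two different faces that are joined in the dual graph by edges outside `T`
is dual to an edge of `T`: the dual edges of the edges outside `T` form a forest. -/
theorem mem_edgeSet_of_reachable (hV : V(G).Finite) (hE : E(G).Finite) (hT : G.IsSpanningTree T)
    {g : β} {X Y : Set ℂ} (hg : D.dual.IsLink g X Y) (hXY : X ≠ Y) {S : Set β}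
    (hST : Disjoint S E(T)) (hgS : g ∉ S) (h : (D.dual.restrict S).Reachable X Y) : g ∈ E(T) := by
  by_contra hgT
  have hVT : V(T) = V(G) := hT.1.vertexSet_eq
  obtain ⟨u, hu⟩ := hT.2.1.1
  refine hXY (eq_of_reachable_of_isLink hV hE hg
    ((component_subset u).trans hT.1.le.vertexSet_mono)
    ((component_edges_subset u).trans hT.1.le.edgeSet_mono)
    (fun hg' => hgT (component_edges_subset u hg')) hgS
    (hST.mono_right (component_edges_subset u))
    (isPreconnected_sketch_component hT.1.le hu) (fun x hx => ?_) h)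
  exact hT.2.1.2 u hu x (hVT ▸ hx.vertex_mem)

/-- Suppose that an edge `e` outside `T` separates two faces that are still joined in the dual graph
when the edges of `T - g` and `e` may not be crossed.  Then `e` joins the two components of
`T - g`: if both of its ends lay in the same component, then the faces would be separated by the
cycle that `e` forms with this component. -/
theorem mem_detourEdges (hV : V(G).Finite) (hE : E(G).Finite) (hT : G.IsSpanningTree T) {g : β}
    (hg : g ∈ E(T)) {e : β} (heT : e ∉ E(T)) {X Y : Set ℂ} (he : D.dual.IsLink e X Y)
    (hXY : X ≠ Y) {S : Set β} (hST : Disjoint S (E(T) \ {g})) (heS : e ∉ S)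
    (h : (D.dual.restrict S).Reachable X Y) : e ∈ G.detourEdges T g := by
  have hVT : V(T) = V(G) := hT.1.vertexSet_eq
  obtain ⟨u, v, hguv⟩ := T.exists_isLink_of_mem_edgeSet hg
  set H := T.deleteEdges {g} with hH
  have hHT : H ≤ T := Graph.deleteEdges_le
  have hHE : ∀ w, {e | ∃ x ∈ H.component w, H.Inc e x} ⊆ E(T) \ {g} := by
    intro w f hf
    have : f ∈ E(T.deleteEdges {g}) := component_edges_subset w hf
    rwa [Graph.edgeSet_deleteEdges] at this
  -- The two ends of `e` do not lie in the same component.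
  have key : ∀ w ∈ V(T), ¬ ∀ x, G.Inc e x → x ∈ H.component w := by
    intro w hw hall
    have hwH : w ∈ V(H) := hw
    exact hXY (eq_of_reachable_of_isLink hV hE he
      ((component_subset w).trans (hHT.vertexSet_mono.trans hT.1.le.vertexSet_mono))
      ((hHE w).trans (Set.sdiff_subset.trans hT.1.le.edgeSet_mono))
      (fun h' => heT (hHE w h').1) heS (hST.mono_right (hHE w))
      (isPreconnected_sketch_component (hHT.trans hT.1.le) hwH) hall h)
  have heG : e ∈ E(G) := (dual_isLink_left he).2.1
  obtain ⟨x, y, hxy⟩ := G.exists_isLink_of_mem_edgeSet heG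
  have hcov : ∀ z, z ∈ V(G) → z ∈ H.component u ∨ z ∈ H.component v := fun z hz =>
    Graph.Reachable.deleteEdges_or hguv (hT.2.1.2 z (hVT ▸ hz) u hguv.left_mem)
  have hinc : ∀ {W : Set α}, x ∈ W → y ∈ W → ∀ z, G.Inc e z → z ∈ W := by
    intro W hx hy z hz
    rcases hz.eq_or_eq_of_isLink hxy with rfl | rfl
    exacts [hx, hy]
  rcases hcov x hxy.left_mem with hx | hx <;> rcases hcov y hxy.right_mem with hy | hy
  · exact absurd (hinc hx hy) (key u hguv.left_mem)
  · exact ⟨u, v, hguv, x, hx, y, hy, hxy⟩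
  · exact ⟨u, v, hguv, y, hy, x, hx, hxy.symm⟩
  · exact absurd (hinc hx hy) (key v hguv.right_mem)

section SearchTree

variable {O : Set ℂ} (τ : (D.dual.restrict (E(G) \ E(T))).SearchTree O) {X Y : Set ℂ}

theorem disjoint_pathEdges_edgeSet (hX : D.IsFace X) : Disjoint (τ.pathEdges X) E(T) :=
  Set.disjoint_left.2 fun _ he => (τ.pathEdges_subset hX he).2.2

/-- The fundamental cycle of a dual edge `g` with respect to the search tree consists of edges that
are counted in the congestion of `g`. -/
theorem depth_add_depth_add_one_le (hV : V(G).Finite) (hE : E(G).Finite)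
    (hT : G.IsSpanningTree T) (hX : D.IsFace X) (hY : D.IsFace Y) (hXY : X ≠ Y) {g : β}
    (hg : D.dual.IsLink g X Y) (hdisj : Disjoint (τ.pathEdges X) (τ.pathEdges Y))
    (hgX : g ∉ τ.pathEdges X) (hgY : g ∉ τ.pathEdges Y) :
    (τ.depth X + τ.depth Y + 1 : ℕ∞) ≤ G.edgeCongestion T := by
  have hQ : D.dual.restrict (E(G) \ E(T)) ≤ D.dual := Graph.restrict_le
  have hdX := disjoint_pathEdges_edgeSet τ hX
  have hdY := disjoint_pathEdges_edgeSet τ hY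
  have hgT : g ∈ E(T) := by
    refine mem_edgeSet_of_reachable hV hE hT hg hXY (S := τ.pathEdges X ∪ τ.pathEdges Y)
      (Set.disjoint_union_left.2 ⟨hdX, hdY⟩) (fun h => h.elim hgX hgY) ?_
    exact (τ.reachable_root hQ hX Set.subset_union_left).trans
      (τ.reachable_root hQ hY Set.subset_union_right).symm
  have key : ∀ {X Y : Set ℂ}, D.IsFace X → D.IsFace Y → D.dual.IsLink g X Y →
      Disjoint (τ.pathEdges X) (τ.pathEdges Y) → g ∉ τ.pathEdges X →
      τ.pathEdges X ⊆ G.detourEdges T g := by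
    rintro X Y hX hY hg hdisj hgX e ⟨i, hi, rfl⟩
    have heX : τ.edge (τ.par^[i] X) ∈ τ.pathEdges X := ⟨i, hi, rfl⟩
    have hl := τ.isLink_iterate hX hi
    obtain ⟨-, h1⟩ := τ.iterate_par hX hi.le
    obtain ⟨-, h2⟩ := τ.iterate_par hX (k := i + 1) hi
    have hne : τ.par^[i] X ≠ τ.par^[i + 1] X := fun h => by
      rw [← h] at h2
      omega
    refine mem_detourEdges hV hE hT hgT hl.edge_mem.2.2 (hl.mono hQ) hne
      (S := (τ.pathEdges X \ {τ.edge (τ.par^[i] X)} ∪ τ.pathEdges Y) ∪ {g}) ?_ ?_ ?_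
    · rw [Set.disjoint_left]
      rintro f ((hf | hf) | hf) ⟨hfT, hfg⟩
      · exact Set.disjoint_left.1 (disjoint_pathEdges_edgeSet τ hX) hf.1 hfT
      · exact Set.disjoint_left.1 (disjoint_pathEdges_edgeSet τ hY) hf hfT
      · exact hfg hf
    · rintro ((h | h) | h)
      · exact h.2 rfl
      · exact Set.disjoint_left.1 hdisj heX h
      · exact hgX (Set.mem_singleton_iff.1 h ▸ heX)
    · exact τ.reachable_of_isLink hQ hX hY hg hi (fun e he hne => Or.inl (Or.inl ⟨he, hne⟩))
        (fun e he => Or.inl (Or.inr he)) (Or.inr rfl)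
  have hsub : insert g (τ.pathEdges X ∪ τ.pathEdges Y) ⊆ G.detourEdges T g :=
    Set.insert_subset (Graph.mem_detourEdges_self hT.1.le hgT)
      (Set.union_subset (key hX hY hg hdisj hgX) (key hY hX hg.symm hdisj.symm hgY))
  refine le_trans (le_of_eq ?_) ((Set.encard_le_encard hsub).trans
    (Graph.encard_detourEdges_le hgT))
  rw [Set.encard_insert_of_notMem fun h => h.elim hgX hgY, Set.encard_union_eq hdisj,
    τ.encard_pathEdges hX, τ.encard_pathEdges hY]

/-- Adjacent interior faces in different branches of the search tree. -/
theorem depth_add_depth_add_one_le_of_label_ne (hV : V(G).Finite) (hE : E(G).Finite)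
    (hT : G.IsSpanningTree T) (hXO : X ≠ O) (hYO : Y ≠ O) (hXY : D.dual.Adj X Y)
    (h : τ.label X ≠ τ.label Y) :
    (τ.depth X + τ.depth Y + 1 : ℕ∞) ≤ G.edgeCongestion T := by
  obtain ⟨g, hg⟩ := hXY
  have hX := (dual_isLink_left hg).1
  have hY := (dual_isLink_left hg.symm).1
  have key : ∀ {X Y : Set ℂ}, D.IsFace X → Y ≠ O → D.dual.IsLink g X Y →
      τ.label X ≠ τ.label Y → g ∉ τ.pathEdges X := fun hX hYO hg h hgX =>
    τ.notMem_pathEdges hX ⟨τ.pathEdges_subset hX hgX |>.2, hg⟩ hYO h hgX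
  exact depth_add_depth_add_one_le τ hV hE hT hX hY (fun h' => h (h' ▸ rfl)) hg
    (τ.disjoint_pathEdges hX hY h) (key hX hYO hg h) (key hY hXO hg.symm h.symm)

/-- A face that is adjacent to the root.  If the edge between them belongs to the search tree, then
the path from the face to the root has length one, and the bound holds because the edge is
not a loop. -/
theorem depth_add_one_le_of_adj_root (hV : V(G).Finite) (hE : E(G).Finite)
    (hT : G.IsSpanningTree T) (hO : D.IsFace O) (hXO : X ≠ O) (hX : D.dual.Adj X O)
    (hloop : ∀ x, ¬ G.IsLoopAt (τ.label X) x) :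
    (τ.depth X + 1 : ℕ∞) ≤ G.edgeCongestion T := by
  obtain ⟨g, hg⟩ := hX
  have hX := (dual_isLink_left hg).1
  have hpO := τ.pathEdges_root
  by_cases hgX : g ∈ τ.pathEdges X
  · obtain ⟨-, -, hp⟩ := τ.eq_par_of_mem_pathEdges hX hgX ⟨τ.pathEdges_subset hX hgX |>.2, hg⟩
    have hd := τ.depth_eq X hX hXO
    rw [← hp, τ.depth_root] at hd
    obtain ⟨y, -, hy⟩ := τ.exists_isLink_label hX hXO
    obtain ⟨heG, heT⟩ := hy.edge_mem.2
    obtain ⟨a, b, hab⟩ := G.exists_isLink_of_mem_edgeSet heG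
    have := Graph.two_le_edgeCongestion hT hab (fun h => hloop a (by rw [← h] at hab; exact hab))
      heT
    rw [hd]
    exact this
  · have := depth_add_depth_add_one_le τ hV hE hT hX hO hXO hg
      (by rw [hpO]; exact disjoint_bot_right) hgX (by rw [hpO]; exact Set.notMem_empty g)
    simpa [τ.depth_root] using this

end SearchTree

section Outer

variable (τ : (D.dual.restrict (E(G) \ E(T))).SearchTree D.outerFace) {X : Set ℂ}

theorem isOuterEdge_label (hX : D.IsFace X) (hXO : X ≠ D.outerFace) :
    D.IsOuterEdge (τ.label X) := by
  obtain ⟨Y, hY, hl⟩ := τ.exists_isLink_label hX hXO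
  have h1 := dual_isLink_left hl.2
  have h2 := dual_isLink_left hl.2.symm
  exact ⟨h2.2, Y, ⟨h1.1, hY⟩, h1.2⟩

theorem index_label_le (hX : D.IsFace X) (hXO : X ≠ D.outerFace) :
    D.index X (τ.label X) ≤ τ.depth X := by
  obtain ⟨p, hp, hlen, -, hhead⟩ := τ.exists_isPath hX
  obtain ⟨q, hq1, hq2⟩ := p.exists_walk_of_le Graph.restrict_le
  refine iInf₂_le_of_le q ⟨?_, ?_⟩ ?_
  · rw [Graph.Walk.IsPath, hq1]
    exact hp
  · rw [hq2]
    exact hhead hXO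
  · rw [← hlen, Graph.Walk.length, Graph.Walk.length, hq2]

end Outer

end PlaneDrawing

/-! ### Labels along walks -/

namespace Graph.Walk

variable {α β γ : Type*} {Q : Graph α β}

/-- A function that changes between the ends of a walk changes along one of its edges. -/
theorem exists_adj_ne {x y : α} (p : Q.Walk x y) (f : α → γ) (h : f x ≠ f y) :
    ∃ a b, Q.Adj a b ∧ f a ≠ f b := by
  induction p with
  | nil hx => exact absurd rfl h
  | @cons x y z e hl p ih =>
    by_cases hxy : f x = f y
    · exact ih (hxy ▸ h)
    · exact ⟨x, y, hl.adj, hxy⟩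

theorem exists_support_eq_cons {x y : α} (p : Q.Walk x y) :
    ∃ l, p.support = x :: l := by
  cases p with
  | nil hx => exact ⟨[], rfl⟩
  | cons e h p => exact ⟨p.support, rfl⟩

/-- Follow a path from `x` to `z` and disregard `z`.  Either `f` keeps the value `f x` up to the
last vertex, which is adjacent to `z`, or there is a first vertex where the value changes. -/
theorem IsPath.label_change {x z : α} {p : Q.Walk x z} (hp : p.IsPath) (hxz : x ≠ z) (f : α → γ)
    (d : α) :
    (p.support.dropLast.getLastD d ≠ z ∧ Q.Adj (p.support.dropLast.getLastD d) z ∧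
      f (p.support.dropLast.getLastD d) = f x) ∨
    ∃ a b, [a, b] <:+: p.support.dropLast ∧ a ≠ z ∧ b ≠ z ∧ Q.Adj a b ∧ f a = f x ∧ f b ≠ f x := by
  induction p generalizing d with
  | nil hx => exact absurd rfl hxz
  | @cons x y z e hl p ih =>
    obtain ⟨hxp, hp'⟩ := List.nodup_cons.1 hp
    obtain ⟨l, hlp⟩ := p.exists_support_eq_cons
    by_cases hyz : y = z
    · subst hyz
      have hl0 : l = [] := by
        cases p with
        | nil _ => exact (List.cons.inj hlp).2.symm
        | cons e h p => exact absurd p.mem_support_right (List.nodup_cons.1 hp').1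
      rw [support, hlp, hl0]
      exact Or.inl ⟨hxz, hl.adj, rfl⟩
    · have hlne : l ≠ [] := by
        rintro rfl
        have := p.mem_support_right
        rw [hlp] at this
        exact hyz (List.mem_singleton.1 this).symm
      have hdrop : p.support.dropLast = y :: l.dropLast := by
        rw [hlp, List.dropLast_cons_of_ne_nil hlne]
      have hdrop' : (cons e hl p).support.dropLast = x :: p.support.dropLast := by
        rw [support, List.dropLast_cons_of_ne_nil (by rw [hlp]; exact List.cons_ne_nil _ _)]
      rw [hdrop', List.getLastD_cons]
      by_cases hfy : f y = f x
      · rcases ih hp' hyz x with ⟨h1, h2, h3⟩ | ⟨a, b, h1, h2, h3, h4, h5, h6⟩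
        · exact Or.inl ⟨h1, h2, h3.trans hfy⟩
        · exact Or.inr ⟨a, b, h1.trans (List.suffix_cons _ _).isInfix, h2, h3, h4, h5.trans hfy,
            fun h => h6 (h.trans hfy.symm)⟩
      · refine Or.inr ⟨x, y, ?_, hxz, hyz, hl.adj, rfl, hfy⟩
        rw [hdrop]
        exact List.IsPrefix.isInfix ⟨l.dropLast, rfl⟩

end Graph.Walk

/-! ### Center-tail systems -/

theorem CenterTailSystem.congestionIndicator_le_edgeCongestion {α β : Type*} {G T : Graph α β}
    (hV : V(G).Finite) (hE : E(G).Finite) {D : PlaneDrawing G}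
    (hloop : ∀ e, D.IsOuterEdge e → ∀ x, ¬ G.IsLoopAt e x) (S : CenterTailSystem D)
    (hT : G.IsSpanningTree T) : S.congestionIndicator ≤ G.edgeCongestion T := by
  have hO := PlaneDrawing.isFace_outerFace (D := D) hV hE
  set Q := D.dual.restrict (E(G) \ E(T)) with hQ
  have hreach : ∀ X, D.IsFace X → Q.Reachable X D.outerFace := fun X hX =>
    PlaneDrawing.reachable_dual_restrict hV hE hT hX hO
  obtain ⟨C, hC⟩ : S.center.Nonempty := S.center_connected.1
  have hne : Nonempty β := by
    obtain ⟨p⟩ := hreach C (S.center_inner C hC).1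
    cases p with
    | nil _ => exact absurd rfl (S.center_inner _ hC).2
    | cons e _ _ => exact ⟨e⟩
  obtain ⟨τ⟩ : Nonempty (Q.SearchTree D.outerFace) := Graph.nonempty_searchTree hO hreach
  have houter : ∀ {X}, D.IsFace X → X ≠ D.outerFace → D.IsOuterEdge (τ.label X) := fun hX hXO =>
    PlaneDrawing.isOuterEdge_label τ hX hXO
  have hindex : ∀ {X}, D.IsFace X → X ≠ D.outerFace → D.index X (τ.label X) ≤ τ.depth X :=
    fun hX hXO => PlaneDrawing.index_label_le τ hX hXO
  have hpair : ∀ {X Y}, X ≠ D.outerFace → Y ≠ D.outerFace → D.dual.Adj X Y →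
      τ.label X ≠ τ.label Y →
      D.index X (τ.label X) + D.index Y (τ.label Y) + 1 ≤ G.edgeCongestion T := by
    intro X Y hXO hYO hXY h
    refine le_trans ?_
      (PlaneDrawing.depth_add_depth_add_one_le_of_label_ne τ hV hE hT hXO hYO hXY h)
    gcongr
    · exact hindex hXY.left_mem hXO
    · exact hindex hXY.right_mem hYO
  by_cases hlab : ∀ F ∈ S.center, τ.label F = τ.label C
  · -- All faces of the center lie in the same branch of the search tree.
    have hCin := S.center_inner C hC
    let e : {e : β // D.IsOuterEdge e} := ⟨τ.label C, houter hCin.1 hCin.2⟩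
    have hstart := S.start_mem_center _ (S.opp_mem_tails e)
    have hlabs : τ.label (S.opp e).start = e := hlab _ hstart
    have htail := (S.opp e).isPath.label_change (S.opp e).start_inner.2 τ.label (S.opp e).start
    rcases htail with ⟨h1, h2, h3⟩ | ⟨F, F', h1, hF, hF', hadj, h4, h5⟩
    · refine (min_le_right _ _).trans ((min_le_left _ _).trans (iInf_le_of_le e ?_))
      have htip : τ.label (S.opp e).tip = e := h3.trans hlabs
      have hle := hindex (X := (S.opp e).tip) h2.left_mem h1
      rw [htip] at hle
      refine (add_le_add_left hle 1).trans ?_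
      exact PlaneDrawing.depth_add_one_le_of_adj_root τ hV hE hT hO h1 h2
        (hloop _ (houter h2.left_mem h1))
    · refine (min_le_right _ _).trans ((min_le_right _ _).trans ?_)
      let e' : {e : β // D.IsOuterEdge e} := ⟨τ.label F', houter hadj.right_mem hF'⟩
      have hee : e' ≠ e := fun h => h5 ((congrArg Subtype.val h).trans hlabs.symm)
      refine iInf_le_of_le e (iInf₂_le_of_le F F' (iInf₂_le_of_le h1 e' (iInf_le_of_le hee ?_)))
      have := hpair hF hF' hadj fun h => h5 (h.symm.trans h4)
      rwa [h4, hlabs] at this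
  · -- Two adjacent faces of the center lie in different branches.
    push Not at hlab
    obtain ⟨F, hF, hFC⟩ := hlab
    obtain ⟨p⟩ := S.center_connected.2 F hF C hC
    obtain ⟨X, Y, ⟨g, hg⟩, hXY⟩ := p.exists_adj_ne τ.label hFC
    obtain ⟨hl, hX, hY⟩ : D.dual.IsLink g X Y ∧ X ∈ S.center ∧ Y ∈ S.center := hg
    have hXin := S.center_inner X hX
    have hYin := S.center_inner Y hY
    refine (min_le_left _ _).trans ?_
    refine iInf₂_le_of_le X hX (iInf₂_le_of_le Y hY (iInf_le_of_le
      ⟨fun h => hXY (h ▸ rfl), hl.adj⟩ (iInf₂_le_of_le ⟨_, houter hXin.1 hXin.2⟩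
        ⟨_, houter hYin.1 hYin.2⟩ (iInf_le_of_le (fun h => hXY (congrArg Subtype.val h)) ?_))))
    exact hpair hXin.2 hYin.2 hl.adj hXY

theorem theorem1 {α β : Type*} (G : Graph α β) (hV : V(G).Finite) (hE : E(G).Finite)
    (hG : G.Connected) (D : PlaneDrawing G)
    (hloop : ∀ e, D.IsOuterEdge e → ∀ x, ¬ G.IsLoopAt e x)
    (S : CenterTailSystem D) :
    S.congestionIndicator ≤ G.spanningTreeCongestion :=
  le_iInf₂ fun _ hT => S.congestionIndicator_le_edgeCongestion hV hE hloop hT
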